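/- Let $k$ be a field of characteristic different from $2$ and $3$, let $E: y^2=x^3+ax+b$ be an elliptic curve over $k$ with point at infinity $P_\infty$, and let $\ell$ be a prime different from the characteristic of $k$. Assume that the full (geometric) $\ell$-torsion $E[\ell]$ has a basis $W_1,W_2$ consisting of $k$-rational points. Normalize a polynomial function $f\in k[x,y]/(y^2-x^3-ax-b)$ with a pole of order $n$ at $P_\infty$ by requiring that its monomial with pole of order exactly $n$ at $P_\infty$ (that is, $x^{n/2}$ if $n$ is even, $x^{(n-3)/2}y$ if $n$ is odd) has coefficient $1$. For $W\in E[\ell]\setminus\{P_\infty\}$ let $h_W$ be the normalized polynomial function with $$\operatorname{div}(h_W)=\ell W-\ell P_\infty .$$ Let $Q\in E(k)$ with $Q\neq P_\infty$, $Q\ne -W_1$ and $Q\neq -W_2$. For $P\in E(k)$ with $\ell P=Q$ let $g_P$ be the normalized polynomial function with $$\operatorname{div}(g_P)=\ell P+(-Q)-(\ell+1)P_\infty .$$ 1. Let $\omega_1,\omega_2\in k$ satisfy $\omega_i^\ell=h_{W_i}(-Q)$ for $i=1,2$. If a point $P\in E(k)$ with $\ell P=Q$ is a solution of the system $$g_P(W_i)=\omega_i\,h_{W_i}(P),\qquad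 i=1,2,$$ then no point $P+W$ with $W\in E[\ell]$, $W\neq P_\infty$, is a solution of it (that is, the system fails when $P$ is replaced by $P+W$ throughout). 2. Write $G_{W_1}(P)=g_P(W_1)/h_{W_1}(P)$. For every $P\in E(k)$ with $\ell P=Q$, the map $$E[\ell]\to\mu_\ell,\qquad W\mapsto \frac{G_{W_1}(P+W)}{G_{W_1}(P)},$$ is a surjective group homomorphism onto the group $\mu_\ell$ of all $\ell$-th roots of unity in an algebraic closure of $k$. -/

import Mathlib

open Polynomial

namespace EllipticDivision

open WeierstrassCurve.Affine

variable {k : Type*} [Field k] {E : WeierstrassCurve.Affine k}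

/-- The ideal of the affine coordinate ring `k[E]` of the functions vanishing at the point `P`;
the point at infinity lies outside the affine curve, its ideal is the whole ring. -/
noncomputable def pointIdeal : E.Point → Ideal E.CoordinateRing
  | .zero => ⊤
  | .some x y _ => CoordinateRing.XYIdeal E x (C y)

/-- `1` for an affine point and `0` for the point at infinity. -/
def affineCount : E.Point → ℕ
  | .zero => 0
  | .some _ _ _ => 1

/-- The value `f(P)` of a polynomial function `f ∈ k[E]` at an affine point `P = (x, y)`
(and the dummy value `0` at the point at infinity). -/
noncomputable def value (f : E.CoordinateRing) : E.Point → k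
  | .zero => 0
  | .some x y h => AdjoinRoot.lift (evalRingHom x) y (by
      have := h.left
      rwa [Equation, ← eval₂_evalRingHom] at this) f

/-- The polynomial function `f = p(x) + q(x) y` lies in the span of the `x ^ i` with `2 i ≤ n` and
of the `x ^ j y` with `2 j + 3 ≤ n`, i.e. in the Riemann-Roch space `L(n P_∞)`, and in it the
monomial with a pole of order exactly `n`, which is `x ^ (n / 2)` for even `n` and
`x ^ ((n - 3) / 2) y` for odd `n`, has coefficient `1`. In particular `f` has a pole of order
exactly `n` at the point at infinity.
(The outer variable `X` of `k[X][X]` is the coordinate `y`.) -/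
def IsMonicAtInfinity (n : ℕ) (f : E.CoordinateRing) : Prop :=
  ∃ p q : k[X], f = p • (1 : E.CoordinateRing) + q • CoordinateRing.mk E X ∧
    (∀ i, p.coeff i ≠ 0 → 2 * i ≤ n) ∧ (∀ j, q.coeff j ≠ 0 → 2 * j + 3 ≤ n) ∧
    (if Even n then p.coeff (n / 2) else q.coeff ((n - 3) / 2)) = 1

/-- For affine points `P₁, …, Pₙ` (with repetitions), `f ∈ k[E]` has divisor
`P₁ + ⋯ + Pₙ - n P_∞` and is normalized at infinity. On the affine part of the curve, which is
smooth, the divisor of `f` is the factorization of the ideal `(f)` into the ideals of points.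
Copies of `P_∞` among the `Pᵢ` cancel in the divisor. -/
structure IsNormalizedWithZeros (s : Multiset E.Point) (f : E.CoordinateRing) : Prop where
  span_eq : Ideal.span {f} = (s.map pointIdeal).prod
  monic : IsMonicAtInfinity (s.map affineCount).sum f

section WellDefined

open CoordinateRing nonZeroDivisors

/-- Two polynomial functions with the same zero divisor, both normalized, coincide. -/
theorem IsNormalizedWithZeros.unique {s : Multiset E.Point} {f g : E.CoordinateRing}
    (hf : IsNormalizedWithZeros s f) (hg : IsNormalizedWithZeros s g) : f = g := by
  obtain ⟨u, hu⟩ := Ideal.span_singleton_eq_span_singleton.mp (hf.span_eq.trans hg.span_eq.symm)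
  obtain ⟨a, b, hab⟩ := exists_smul_basis_eq (u : E.CoordinateRing)
  have hdeg : (Algebra.norm k[X] (u : E.CoordinateRing)).degree = 0 :=
    degree_eq_zero_of_isUnit (u.isUnit.map _)
  rw [← hab, degree_norm_smul_basis] at hdeg
  have hb : b = 0 := by
    by_contra hb
    have := hdeg ▸ le_max_right (2 • a.degree) (2 • b.degree + 3)
    rw [degree_eq_natDegree hb] at this
    norm_cast at this
  have ha : a.degree = 0 := by
    subst hb
    have ha0 : a ≠ 0 := by
      rintro rfl
      simp at hdeg
    rw [degree_eq_natDegree ha0] at hdeg ⊢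
    simp only [degree_zero] at hdeg
    have h1 : (2 • (⊥ : WithBot ℕ) + 3) = ⊥ := rfl
    rw [h1, max_bot_right] at hdeg
    norm_cast at hdeg ⊢
    simpa using hdeg
  obtain ⟨c, rfl⟩ : ∃ c, a = C c := ⟨_, eq_C_of_degree_eq_zero ha⟩
  subst hb
  obtain ⟨p, q, hp, -, -, hp1⟩ := hf.monic
  obtain ⟨p', q', hp', -, -, hp1'⟩ := hg.monic
  have key : (p * C c - p') • (1 : E.CoordinateRing) + (q * C c - q') • CoordinateRing.mk E X = 0 := by
    have h2 : f * CoordinateRing.mk E (C (C c)) = g := by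
      rw [← hu, ← hab, CoordinateRing.smul]
      simp
    rw [hp, smul_basis_mul_C] at h2
    rw [sub_smul, sub_smul, sub_add_sub_comm, h2, hp', sub_self]
  obtain ⟨h3, h4⟩ := smul_basis_eq_zero key
  have hc : c = 1 := by
    rw [← sub_eq_zero.mp h3, ← sub_eq_zero.mp h4] at hp1'
    simp only [coeff_mul_C, ← ite_mul] at hp1'
    rwa [hp1, one_mul] at hp1'
  rw [hp, hp', ← sub_eq_zero.mp h3, ← sub_eq_zero.mp h4, hc]
  simp

theorem eval₂_negPolynomial : eval₂ (AdjoinRoot.of E.polynomial)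
    (AdjoinRoot.mk E.polynomial E.negPolynomial) E.polynomial = 0 := by
  have h : CoordinateRing.mk E (E.polynomial.comp E.negPolynomial) = 0 := by
    have : E.polynomial.comp E.negPolynomial = E.polynomial := by
      rw [WeierstrassCurve.Affine.polynomial, negPolynomial]
      simp only [sub_comp, add_comp, mul_comp, pow_comp, X_comp, C_comp]
      ring
    rw [this, AdjoinRoot.mk_self]
  rw [comp, hom_eval₂] at h
  exact h

/-- The involution `y ↦ - y - a₁ x - a₃` of the coordinate ring. -/
noncomputable def conj : E.CoordinateRing →+* E.CoordinateRing :=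
  AdjoinRoot.lift (AdjoinRoot.of E.polynomial) (AdjoinRoot.mk E.polynomial E.negPolynomial)
    eval₂_negPolynomial

theorem mul_conj (f : E.CoordinateRing) :
    f * conj f = CoordinateRing.mk E (C (Algebra.norm k[X] f)) := by
  obtain ⟨p, q, rfl⟩ := exists_smul_basis_eq f
  have := coe_norm_smul_basis (W' := E) p q
  refine Eq.trans ?_ (Eq.trans this.symm ?_)
  · rw [map_mul, CoordinateRing.smul, CoordinateRing.smul]
    simp [conj, AdjoinRoot.mk_X, negPolynomial]
  · rfl

/-- `x - x(P)`, and `1` for the point at infinity. -/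
noncomputable def xFactor : E.Point → k[X]
  | .zero => 1
  | .some x _ _ => X - C x

theorem pointIdeal_mul_conj (P : E.Point) :
    pointIdeal P * (pointIdeal P).map conj =
      Ideal.span {CoordinateRing.mk E (C (xFactor P))} := by
  rcases P with _ | ⟨x, y, h⟩
  · simp [pointIdeal, xFactor, Ideal.map_top]
  · have h1 : (XYIdeal E x (C y)).map conj = XYIdeal E x (C (E.negY x y)) := by
      have hX : conj (XClass E x) = XClass E x := by
        rw [conj, XClass, AdjoinRoot.lift_mk, eval₂_C]
        rfl
      have hY : conj (YClass E (C y)) =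
          -(YClass E (C (E.negY x y)) + XClass E x * CoordinateRing.mk E (C (C E.a₁))) := by
        simp only [conj, YClass, XClass, AdjoinRoot.lift_mk, eval₂_sub, eval₂_X, eval₂_C, negY,
          negPolynomial]
        change _ - CoordinateRing.mk E (C (C y)) = _
        rw [← map_sub, ← map_mul, ← map_add, ← map_neg]
        congr 1
        simp only [C_sub, C_neg, C_add, C_mul]
        ring
      rw [XYIdeal, XYIdeal, Ideal.map_span, Set.image_pair, hX, hY]
      apply le_antisymm <;> rw [Ideal.span_le, Set.insert_subset_iff, Set.singleton_subset_iff]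
      · exact ⟨Ideal.subset_span (by simp), neg_mem (add_mem (Ideal.subset_span (by simp))
          (Ideal.mul_mem_right _ _ (Ideal.subset_span (by simp))))⟩
      · refine ⟨Ideal.subset_span (by simp), Ideal.mem_span_pair.mpr
          ⟨-CoordinateRing.mk E (C (C E.a₁)), -1, by ring⟩⟩
    simp only [pointIdeal, xFactor]
    rw [h1, mul_comm, XYIdeal_neg_mul h]
    rfl

theorem two_nsmul_coe (n : ℕ) : 2 • (n : WithBot ℕ) = ((2 * n : ℕ) : WithBot ℕ) := by
  rw [two_nsmul, two_mul]
  rfl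

theorem degree_norm_of_span_eq {s : Multiset E.Point} {f : E.CoordinateRing}
    (hf : Ideal.span {f} = (s.map pointIdeal).prod) :
    (Algebra.norm k[X] f).degree = ((s.map affineCount).sum : ℕ) := by
  have h1 : Ideal.span {f * conj f} =
      Ideal.span {CoordinateRing.mk E (C (s.map xFactor).prod)} := by
    have h2 : Ideal.span {conj f} = ((s.map pointIdeal).prod).map conj := by
      rw [← hf, Ideal.map_span, Set.image_singleton]
    rw [← Ideal.span_singleton_mul_span_singleton, h2, hf]
    clear h2 hf
    induction s using Multiset.induction with
    | empty => simp [Ideal.map_top, Ideal.one_eq_top]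
    | cons P s ih =>
      simp only [Multiset.map_cons, Multiset.prod_cons, Ideal.map_mul, map_mul]
      rw [mul_mul_mul_comm, ih, pointIdeal_mul_conj, Ideal.span_singleton_mul_span_singleton]
  rw [mul_conj] at h1
  have hmon : (s.map xFactor).prod.Monic ∧
      (s.map xFactor).prod.natDegree = (s.map affineCount).sum := by
    clear h1 hf
    induction s using Multiset.induction with
    | empty => simp
    | cons P s ih =>
      have hP : (xFactor P).Monic ∧ (xFactor P).natDegree = affineCount P := by
        rcases P with _ | ⟨x, y, h⟩
        · simp [xFactor, affineCount]
        · exact ⟨monic_X_sub_C x, natDegree_X_sub_C x⟩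
      simp only [Multiset.map_cons, Multiset.prod_cons, Multiset.sum_cons]
      exact ⟨hP.1.mul ih.1, by rw [hP.1.natDegree_mul ih.1, hP.2, ih.2]⟩
  obtain ⟨u, hu⟩ := Ideal.span_singleton_eq_span_singleton.mp h1
  have h3 := congrArg (fun z => (Algebra.norm k[X] z).degree) hu
  have hC : ∀ a : k[X], (Algebra.norm k[X] (CoordinateRing.mk E (C a))).degree = 2 • a.degree := by
    intro a
    have := degree_norm_smul_basis (W' := E) a 0
    rw [zero_smul, add_zero, CoordinateRing.smul, mul_one] at this
    rw [this]
    exact max_bot_right _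
  simp only [map_mul, degree_mul, hC, degree_eq_zero_of_isUnit (u.isUnit.map (Algebra.norm k[X])),
    add_zero] at h3
  rw [degree_eq_natDegree hmon.1.ne_zero, hmon.2] at h3
  have h0 : Algebra.norm k[X] f ≠ 0 := by
    intro h0
    rw [h0] at h3
    exact absurd h3 (by rw [degree_zero]; exact (WithBot.bot_lt_coe _).ne)
  rw [degree_eq_natDegree h0] at h3 ⊢
  generalize (s.map affineCount).sum = n at h3 ⊢
  rw [two_nsmul_coe, two_nsmul_coe] at h3
  norm_cast at h3 ⊢
  omega

/-- If `∑ P ∈ s, P = 0` in `E(k)`, there is a normalized function with zero divisor `s`. -/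
theorem exists_isNormalizedWithZeros [DecidableEq k] {s : Multiset E.Point} (hs : s.sum = 0) :
    ∃ f, IsNormalizedWithZeros s f := by
  classical
  let u : E.Point → (FractionalIdeal E.CoordinateRing⁰ E.FunctionField)ˣ := fun P =>
    match P with
    | .zero => 1
    | .some _ _ h => XYIdeal' h
  have hu : ∀ P, ((u P : (FractionalIdeal E.CoordinateRing⁰ E.FunctionField)ˣ) :
      FractionalIdeal E.CoordinateRing⁰ E.FunctionField) = (pointIdeal P : Ideal _) := by
    rintro (_ | ⟨x, y, h⟩)
    · simp [u, pointIdeal]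
    · rfl
  have hcl : ∀ P, Additive.toMul (Point.toClass P) = ClassGroup.mk E.FunctionField (u P) := by
    rintro (_ | ⟨x, y, h⟩)
    · simp only [u, map_one]; rfl
    · rfl
  have h1 : ClassGroup.mk E.FunctionField (s.map u).prod = 1 := by
    have h2 : Additive.toMul (Point.toClass s.sum) = 1 := by rw [hs, map_zero]; rfl
    rw [← h2]
    clear h2 hs
    induction s using Multiset.induction with
    | empty => simp only [Multiset.map_zero, Multiset.prod_zero, map_one]; rfl
    | cons P s ih =>
      rw [Multiset.map_cons, Multiset.prod_cons, map_mul, ih, Multiset.sum_cons, map_add,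
        toMul_add, hcl P]
  have h3 : (((s.map u).prod : (FractionalIdeal E.CoordinateRing⁰ E.FunctionField)ˣ) :
      FractionalIdeal E.CoordinateRing⁰ E.FunctionField) = ((s.map pointIdeal).prod : Ideal _) := by
    clear h1 hs
    induction s using Multiset.induction with
    | empty => simp
    | cons P s ih =>
      rw [Multiset.map_cons, Multiset.prod_cons, Units.val_mul, hu, ih, Multiset.map_cons,
        Multiset.prod_cons, FractionalIdeal.coeIdeal_mul]
  obtain ⟨f, hf0, hf⟩ := (ClassGroup.mk_eq_one_of_coe_ideal h3).mp h1
  obtain ⟨p, q, rfl⟩ := exists_smul_basis_eq f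
  have hdeg := degree_norm_of_span_eq hf.symm
  rw [degree_norm_smul_basis] at hdeg
  obtain ⟨n, hn⟩ : ∃ n, n = (s.map affineCount).sum := ⟨_, rfl⟩
  rw [← hn] at hdeg
  have hp : ∀ i, p.coeff i ≠ 0 → 2 * i ≤ n := by
    intro i hi
    have hp0 : p ≠ 0 := by rintro rfl; simp at hi
    have h4 := hdeg ▸ le_max_left (2 • p.degree) (2 • q.degree + 3)
    rw [degree_eq_natDegree hp0, two_nsmul_coe] at h4
    have h5 := le_natDegree_of_ne_zero hi
    norm_cast at h4
    omega
  have hq : ∀ i, q.coeff i ≠ 0 → 2 * i + 3 ≤ n := by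
    intro i hi
    have hp0 : q ≠ 0 := by rintro rfl; simp at hi
    have h4 := hdeg ▸ le_max_right (2 • p.degree) (2 • q.degree + 3)
    rw [degree_eq_natDegree hp0, two_nsmul_coe] at h4
    have h5 := le_natDegree_of_ne_zero hi
    norm_cast at h4
    omega
  have hc : (if Even n then p.coeff (n / 2) else q.coeff ((n - 3) / 2)) ≠ 0 := by
    rcases max_choice (2 • p.degree) (2 • q.degree + 3) with h | h <;> rw [h] at hdeg
    · have hp0 : p ≠ 0 := by
        rintro rfl
        exact absurd hdeg (by rw [degree_zero]; exact (WithBot.bot_lt_coe _).ne)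
      rw [degree_eq_natDegree hp0, two_nsmul_coe] at hdeg
      norm_cast at hdeg
      rw [if_pos ⟨p.natDegree, by omega⟩, show n / 2 = p.natDegree by omega]
      exact leadingCoeff_ne_zero.mpr hp0
    · have hq0 : q ≠ 0 := by
        rintro rfl
        exact absurd hdeg (by rw [degree_zero]; exact (WithBot.bot_lt_coe _).ne)
      rw [degree_eq_natDegree hq0, two_nsmul_coe] at hdeg
      norm_cast at hdeg
      rw [if_neg (by rw [Nat.not_even_iff]; omega), show (n - 3) / 2 = q.natDegree by omega]
      exact leadingCoeff_ne_zero.mpr hq0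
  set c := if Even n then p.coeff (n / 2) else q.coeff ((n - 3) / 2) with hcdef
  refine ⟨(p • (1 : E.CoordinateRing) + q • CoordinateRing.mk E X) *
    CoordinateRing.mk E (C (C c⁻¹)), ?_, hn ▸ ⟨p * C c⁻¹, q * C c⁻¹, smul_basis_mul_C _ _ _, ?_, ?_, ?_⟩⟩
  · rw [hf]
    refine Ideal.span_singleton_mul_right_unit ?_ _
    exact (((isUnit_iff_ne_zero.mpr (inv_ne_zero hc)).map C).map C).map _
  · intro i hi
    rw [coeff_mul_C] at hi
    exact hp i (left_ne_zero_of_mul hi)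
  · intro i hi
    rw [coeff_mul_C] at hi
    exact hq i (left_ne_zero_of_mul hi)
  · simp only [coeff_mul_C, ← ite_mul]
    exact mul_inv_cancel₀ hc

end WellDefined

/-- The function in `k[E]` with divisor `∑ P ∈ s, (P - P_∞)`, normalized at infinity. -/
noncomputable def normalizedFunction (s : Multiset E.Point) : E.CoordinateRing :=
  Classical.epsilon (IsNormalizedWithZeros s)

theorem normalizedFunction_spec [DecidableEq k] {s : Multiset E.Point} (hs : s.sum = 0) :
    IsNormalizedWithZeros s (normalizedFunction s) :=
  Classical.epsilon_spec (exists_isNormalizedWithZeros hs)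

/-- The Miller function `h_W` of an `ℓ`-torsion point `W`: the normalized function with
`div h_W = ℓ W - ℓ P_∞`. -/
noncomputable def millerFunction (ℓ : ℕ) (W : E.Point) : E.CoordinateRing :=
  normalizedFunction (Multiset.replicate ℓ W)

/-- The function `g_P` attached to `P` with `ℓ P = Q`: the normalized function with
`div g_P = ℓ P + (-Q) - (ℓ + 1) P_∞`. -/
noncomputable def divisionFunction (ℓ : ℕ) (Q P : E.Point) : E.CoordinateRing :=
  normalizedFunction (Multiset.replicate ℓ P + {-Q})

/-- `G_W(P) = g_P(W) / h_W(P)`. -/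
noncomputable def sectorQuotient (ℓ : ℕ) (Q W P : E.Point) : k :=
  value (divisionFunction ℓ Q P) W / value (millerFunction ℓ W) P

/-- `ω` is an `ℓ`-sector of `Q` with respect to `W`. -/
def IsSector (ℓ : ℕ) (Q W : E.Point) (ω : k) : Prop :=
  ω ^ ℓ = value (millerFunction ℓ W) (-Q)

variable [DecidableEq k]

/-- The `k`-rational point `P`, with `ℓ P = Q`, solves `g_P(W_i) = ω_i h_{W_i}(P)`, `i = 1, 2`. -/
structure IsSolution (ℓ : ℕ) (Q W₁ W₂ : E.Point) (ω₁ ω₂ : k) (P : E.Point) : Prop where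
  nsmul_eq : ℓ • P = Q
  eq₁ : value (divisionFunction ℓ Q P) W₁ = ω₁ * value (millerFunction ℓ W₁) P
  eq₂ : value (divisionFunction ℓ Q P) W₂ = ω₂ * value (millerFunction ℓ W₂) P

/-- The rational points `W₁, W₂ ∈ E(k)` form a basis of the geometric `ℓ`-torsion `E[ℓ]`, the
`ℓ`-torsion of `E` over an algebraic closure of `k`. -/
structure IsTorsionBasis [DecidableEq (AlgebraicClosure k)] (ℓ : ℕ) (W₁ W₂ : E.Point) : Prop where
  nsmul_left : ℓ • W₁ = 0
  nsmul_right : ℓ • W₂ = 0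
  indep : ∀ a b : ℤ, a • W₁ + b • W₂ = 0 → (ℓ : ℤ) ∣ a ∧ (ℓ : ℤ) ∣ b
  span : ∀ T : (E.baseChange (AlgebraicClosure k)).toAffine.Point, ℓ • T = 0 →
    ∃ a b : ℤ, T = Point.baseChange (W' := E) k (AlgebraicClosure k) (a • W₁ + b • W₂)

end EllipticDivision

/-! Everything rests on one relation. For independent `ℓ`-torsion points `V, W` there is a constant
`ε ≠ 1`, a value of the Weil pairing, with `G_V(P + W) = ε G_V(P)` for every `P` with `ℓ P = Q`.

Existence of `ε`. The function `h_W(X - V) h_V(X)` has divisor `ℓ(V + W) - ℓ P_∞`, so it is a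
multiple of `h_{V+W}`. Exchanging `V` and `W` gives another multiple, whence `h_V(X - W) h_W(X) = ε
h_W(X - V) h_V(X)` (`exists_commutator`). Likewise `g_{P+W}(X) h_W(P + W - X)` has the divisor of
`g_P`, and comparing leading terms at infinity gives the factor `h_W(P + W)`
(`value_divisionFunction_mul`). Putting `X = P + W` in the first identity and `X = V` in the second
yields the relation (`sectorQuotient_add`).

Nontriviality (`commutator_ne_one`). If `ε = 1`, the operators `f ↦ f(X - W) h_W(X)` and `f ↦ f(X -
V) h_V(X)` on `L(ℓ P_∞)` commute and share an eigenvector `f`. It is not constant, so it has a zero.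
Its zeros are stable under translation by `V` and `W` as long as the result is not `P_∞`, which
produces more than `ℓ` of them. This exceeds the pole order.

Part 1: a nonzero `W` in `E[ℓ]` is independent of `W₁` or of `W₂`, so translation by `W` changes
`G_{W₁}` or `G_{W₂}`, whose values the system prescribes. Part 2: `ε` does not depend on `P`, so `W
↦ G_{W₁}(P + W) / G_{W₁}(P)` is a character; it is nontrivial at `W₂`, hence onto because `ℓ` is
prime.

Translates are handled through their values at points and through ideals of the coordinate ring,
with the degree of the norm as pole order at infinity. The geometric steps take place over an
algebraically closed field and descend by base change. -/

namespace EllipticDivision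

open WeierstrassCurve.Affine

/-! ### Values of polynomial functions and the ideals of points -/

section Values

variable {F : Type*} [Field F] {E : WeierstrassCurve.Affine F}

/-- The coordinate `x` in the coordinate ring. -/
noncomputable def xCoord (E : WeierstrassCurve.Affine F) : E.CoordinateRing :=
  CoordinateRing.mk E (C X)

/-- The coordinate `y` in the coordinate ring. -/
noncomputable def yCoord (E : WeierstrassCurve.Affine F) : E.CoordinateRing :=
  CoordinateRing.mk E X

/-- A constant as an element of the coordinate ring. -/
noncomputable def const (E : WeierstrassCurve.Affine F) : F →+* E.CoordinateRing :=
  (CoordinateRing.mk E).comp (C.comp C)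

theorem smul_eq_const_mul (c : F) (f : E.CoordinateRing) : c • f = const E c * f := by
  rw [Algebra.smul_def]
  rfl

theorem ne_zero_iff_exists_some (P : E.Point) : P ≠ 0 ↔ ∃ x y h, P = .some x y h := by
  rcases P with _ | ⟨x, y, h⟩
  · exact ⟨fun h => (h rfl).elim, fun ⟨_, _, _, h⟩ => by cases h⟩
  · exact ⟨fun _ => ⟨x, y, h, rfl⟩, fun _ => Point.some_ne_zero h⟩

@[simp]
theorem value_zero_point (f : E.CoordinateRing) : value f (0 : E.Point) = 0 := rfl

@[simp]
theorem value_mk {x y : F} (h : E.Nonsingular x y) (p : F[X][X]) :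
    value (CoordinateRing.mk E p) (.some x y h) = p.evalEval x y := by
  rw [value, AdjoinRoot.lift_mk, eval₂_evalRingHom]

theorem value_add (f g : E.CoordinateRing) (P : E.Point) :
    value (f + g) P = value f P + value g P := by
  rcases P with _ | ⟨x, y, h⟩
  · exact (add_zero _).symm
  · simp [value]

theorem value_mul (f g : E.CoordinateRing) (P : E.Point) :
    value (f * g) P = value f P * value g P := by
  rcases P with _ | ⟨x, y, h⟩
  · exact (mul_zero _).symm
  · simp [value]

@[simp]
theorem value_zero (P : E.Point) : value (0 : E.CoordinateRing) P = 0 := by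
  simpa using value_add (0 : E.CoordinateRing) 0 P

theorem value_neg (f : E.CoordinateRing) (P : E.Point) : value (-f) P = -value f P := by
  rw [eq_neg_iff_add_eq_zero, ← value_add, neg_add_cancel, value_zero]

theorem value_sub (f g : E.CoordinateRing) (P : E.Point) :
    value (f - g) P = value f P - value g P := by
  rw [sub_eq_add_neg, value_add, value_neg, sub_eq_add_neg]

theorem value_const (c : F) {P : E.Point} (hP : P ≠ 0) : value (const E c) P = c := by
  obtain ⟨x, y, h, rfl⟩ := (ne_zero_iff_exists_some P).mp hP
  exact (value_mk h _).trans (by simp)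

theorem value_one {P : E.Point} (hP : P ≠ 0) : value (1 : E.CoordinateRing) P = 1 := by
  rw [← map_one (const E), value_const _ hP]

theorem value_smul (c : F) (f : E.CoordinateRing) (P : E.Point) :
    value (c • f) P = c * value f P := by
  rcases eq_or_ne P 0 with rfl | hP
  · simp
  · rw [smul_eq_const_mul, value_mul, value_const _ hP]

theorem value_pow (f : E.CoordinateRing) (n : ℕ) {P : E.Point} (hP : P ≠ 0) :
    value (f ^ n) P = value f P ^ n := by
  induction n with
  | zero => simp [value_one hP]
  | succ n ih => rw [pow_succ, value_mul, ih, pow_succ]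

@[simp]
theorem value_xCoord {x y : F} (h : E.Nonsingular x y) : value (xCoord E) (.some x y h) = x := by
  exact (value_mk h _).trans (by simp [evalEval_C])

@[simp]
theorem value_yCoord {x y : F} (h : E.Nonsingular x y) : value (yCoord E) (.some x y h) = y := by
  exact (value_mk h _).trans (by simp)

theorem value_smul_basis {x y : F} (h : E.Nonsingular x y) (p q : F[X]) :
    value (p • (1 : E.CoordinateRing) + q • CoordinateRing.mk E X) (.some x y h) =
      p.eval x + q.eval x * y := by
  rw [value_add, CoordinateRing.smul, CoordinateRing.smul, value_mul, value_mul,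
    value_one (Point.some_ne_zero h), value_mk, value_mk, value_mk]
  simp [evalEval_C]

/-- Constants, `x` and `y` generate the ring. Statements about evaluation, conjugation and
translation are thereby reduced to these generators. -/
theorem induction_coordinateRing {p : E.CoordinateRing → Prop} (hc : ∀ c, p (const E c))
    (hx : p (xCoord E)) (hy : p (yCoord E)) (hadd : ∀ f g, p f → p g → p (f + g))
    (hmul : ∀ f g, p f → p g → p (f * g)) (f : E.CoordinateRing) : p f := by
  have hpow : ∀ f, p f → ∀ n : ℕ, p (f ^ n) := by
    intro f hf n
    induction n with
    | zero => simpa using hc 1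
    | succ n ih => exact pow_succ f n ▸ hmul _ _ ih hf
  induction f using AdjoinRoot.induction_on with
  | ih f =>
    induction f using Polynomial.induction_on' with
    | add f g hf hg => exact (map_add (CoordinateRing.mk E) f g) ▸ hadd _ _ hf hg
    | monomial n a =>
      rw [← C_mul_X_pow_eq_monomial, map_mul, map_pow]
      refine hmul _ _ ?_ (hpow _ hy n)
      induction a using Polynomial.induction_on' with
      | add f g hf hg => rw [C_add, map_add]; exact hadd _ _ hf hg
      | monomial n a =>
        rw [← C_mul_X_pow_eq_monomial, C_mul, C_pow, map_mul, map_pow]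
        exact hmul _ _ (hc a) (hpow _ hx n)

/-- It suffices to look at generators, since `f g - f(P) g(P) = (f - f(P)) g + f(P) (g - g(P))`. -/
theorem sub_const_value_mem_XYIdeal {x y : F} (h : E.Nonsingular x y) (f : E.CoordinateRing) :
    f - const E (value f (.some x y h)) ∈ CoordinateRing.XYIdeal E x (C y) := by
  have hX : xCoord E - const E x ∈ CoordinateRing.XYIdeal E x (C y) := by
    refine Ideal.subset_span (Or.inl ?_)
    rw [CoordinateRing.XClass, C_sub, map_sub]; rfl
  have hY : yCoord E - const E y ∈ CoordinateRing.XYIdeal E x (C y) := by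
    refine Ideal.subset_span (Or.inr ?_)
    rw [Set.mem_singleton_iff, CoordinateRing.YClass, map_sub]; rfl
  induction f using induction_coordinateRing with
  | hc c => simp [value_const c (Point.some_ne_zero h)]
  | hx => simpa using hX
  | hy => simpa using hY
  | hadd f g hf hg =>
    rw [value_add, map_add, add_sub_add_comm]
    exact add_mem hf hg
  | hmul f g hf hg =>
    rw [value_mul, map_mul]
    have := add_mem (Ideal.mul_mem_right g _ hf)
      (Ideal.mul_mem_left _ (const E (value f (.some x y h))) hg)
    convert this using 1
    ring

theorem mem_pointIdeal_iff (f : E.CoordinateRing) {P : E.Point} (hP : P ≠ 0) :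
    f ∈ pointIdeal P ↔ value f P = 0 := by
  obtain ⟨x, y, h, rfl⟩ := (ne_zero_iff_exists_some P).mp hP
  constructor
  · intro hf
    obtain ⟨a, b, rfl⟩ := Ideal.mem_span_pair.mp hf
    rw [value_add, value_mul, value_mul, CoordinateRing.XClass, CoordinateRing.YClass, value_mk,
      value_mk]
    simp [evalEval_C]
  · intro hf
    have := sub_const_value_mem_XYIdeal h f
    rwa [hf, map_zero, sub_zero] at this

theorem pointIdeal_ne_top {P : E.Point} (hP : P ≠ 0) : pointIdeal P ≠ ⊤ := by
  rw [Ideal.ne_top_iff_one, mem_pointIdeal_iff _ hP, value_one hP]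
  exact one_ne_zero

theorem isMaximal_pointIdeal {P : E.Point} (hP : P ≠ 0) : (pointIdeal P).IsMaximal := by
  refine Ideal.isMaximal_iff.mpr ⟨?_, fun J f hJ hf hfJ => ?_⟩
  · rw [mem_pointIdeal_iff _ hP, value_one hP]
    exact one_ne_zero
  · rw [mem_pointIdeal_iff _ hP] at hf
    have h1 : f - const E (value f P) ∈ J := hJ (by
      rw [mem_pointIdeal_iff _ hP, value_sub, value_const _ hP, sub_self])
    have h2 : const E (value f P) ∈ J := by simpa using sub_mem hfJ h1
    have := J.mul_mem_left (const E (value f P)⁻¹) h2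
    rwa [← map_mul, inv_mul_cancel₀ hf, map_one] at this

theorem pointIdeal_injective {P Q : E.Point} (hP : P ≠ 0) (hQ : Q ≠ 0)
    (h : pointIdeal P ≤ pointIdeal Q) : P = Q := by
  obtain ⟨x, y, hxy, rfl⟩ := (ne_zero_iff_exists_some P).mp hP
  obtain ⟨x', y', hxy', rfl⟩ := (ne_zero_iff_exists_some Q).mp hQ
  have h1 : value (xCoord E - const E x) (.some x' y' hxy') = 0 := by
    rw [← mem_pointIdeal_iff _ hQ]
    refine h ?_
    rw [mem_pointIdeal_iff _ hP, value_sub, value_const _ hP, value_xCoord, sub_self]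
  have h2 : value (yCoord E - const E y) (.some x' y' hxy') = 0 := by
    rw [← mem_pointIdeal_iff _ hQ]
    refine h ?_
    rw [mem_pointIdeal_iff _ hP, value_sub, value_const _ hP, value_yCoord, sub_self]
  rw [value_sub, value_const _ hQ, value_xCoord, sub_eq_zero] at h1
  rw [value_sub, value_const _ hQ, value_yCoord, sub_eq_zero] at h2
  subst h1 h2
  rfl

theorem isCoprime_pointIdeal_pow {P Q : E.Point} (hP : P ≠ 0) (hQ : Q ≠ 0) (h : P ≠ Q)
    (m n : ℕ) : IsCoprime (pointIdeal P ^ m) (pointIdeal Q ^ n) := by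
  refine IsCoprime.pow ?_
  rw [Ideal.isCoprime_iff_sup_eq]
  have := isMaximal_pointIdeal hP
  have := isMaximal_pointIdeal hQ
  exact Ideal.IsMaximal.coprime_of_ne ‹_› ‹_› fun h' => h (pointIdeal_injective hP hQ h'.le)

/-- The zeros of a normalized function are as prescribed. -/
theorem IsNormalizedWithZeros.value_eq_zero_iff {s : Multiset E.Point} {f : E.CoordinateRing}
    (hf : IsNormalizedWithZeros s f) {P : E.Point} (hP : P ≠ 0) : value f P = 0 ↔ P ∈ s := by
  rw [← mem_pointIdeal_iff _ hP, ← Ideal.span_singleton_le_iff_mem, hf.span_eq]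
  constructor
  · intro h
    have := (isMaximal_pointIdeal hP).isPrime
    obtain ⟨R, hR, hRP⟩ := (Ideal.IsPrime.multiset_prod_map_le _ this).mp h
    rcases eq_or_ne R 0 with rfl | hR0
    · exact absurd (top_le_iff.mp hRP) (pointIdeal_ne_top hP)
    · exact pointIdeal_injective hR0 hP hRP ▸ hR
  · intro h
    obtain ⟨t, rfl⟩ := Multiset.exists_cons_of_mem h
    rw [Multiset.map_cons, Multiset.prod_cons]
    exact Ideal.mul_le_inf.trans inf_le_left
end Values

/-! ### Pole order at infinity and the number of zeros -/

section Degree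

variable {F : Type*} [Field F] {E : WeierstrassCurve.Affine F}

/-- The degree of the norm of a polynomial function, which is its pole order at infinity. -/
noncomputable def normDegree (f : E.CoordinateRing) : WithBot ℕ := (Algebra.norm F[X] f).degree

theorem normDegree_smul_basis (p q : F[X]) :
    normDegree (p • (1 : E.CoordinateRing) + q • CoordinateRing.mk E X) =
      max (2 • p.degree) (2 • q.degree + 3) :=
  CoordinateRing.degree_norm_smul_basis p q

theorem normDegree_mul (f g : E.CoordinateRing) :
    normDegree (f * g) = normDegree f + normDegree g := by
  rw [normDegree, map_mul, degree_mul]; rfl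

theorem normDegree_add_le (f g : E.CoordinateRing) :
    normDegree (f + g) ≤ max (normDegree f) (normDegree g) := by
  obtain ⟨p, q, rfl⟩ := CoordinateRing.exists_smul_basis_eq f
  obtain ⟨p', q', rfl⟩ := CoordinateRing.exists_smul_basis_eq g
  rw [add_add_add_comm, ← add_smul, ← add_smul, normDegree_smul_basis, normDegree_smul_basis,
    normDegree_smul_basis]
  have h2 : ∀ a b : F[X], 2 • (a + b).degree ≤ max (2 • a.degree) (2 • b.degree) := by
    intro a b
    rcases le_max_iff.mp (degree_add_le a b) with h | h
    · exact le_max_of_le_left (nsmul_le_nsmul_right h 2)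
    · exact le_max_of_le_right (nsmul_le_nsmul_right h 2)
  refine max_le ((h2 p p').trans (max_le_max (le_max_left _ _) (le_max_left _ _))) ?_
  refine (add_le_add_left (h2 q q') 3).trans ?_
  rw [max_add]
  exact max_le_max (le_max_right _ _) (le_max_right _ _)

@[simp]
theorem normDegree_zero : normDegree (0 : E.CoordinateRing) = ⊥ := by
  have := normDegree_smul_basis (E := E) 0 0
  simp only [zero_smul, add_zero, degree_zero] at this
  rw [this]
  rfl

theorem normDegree_eq_bot {f : E.CoordinateRing} : normDegree f = ⊥ ↔ f = 0 := by
  refine ⟨fun h => ?_, fun h => h ▸ normDegree_zero⟩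
  rw [normDegree, degree_eq_bot] at h
  have := Module.Finite.of_basis (CoordinateRing.basis E)
  exact Algebra.norm_eq_zero_iff.mp h

theorem normDegree_mk_C (p : F[X]) :
    normDegree (CoordinateRing.mk E (C p)) = 2 • p.degree := by
  have := normDegree_smul_basis (E := E) p 0
  rw [zero_smul, add_zero, CoordinateRing.smul, mul_one, degree_zero] at this
  rw [this]
  exact max_bot_right _

theorem normDegree_const {c : F} (hc : c ≠ 0) : normDegree (const E c) = 0 := by
  refine (normDegree_mk_C (C c)).trans ?_
  rw [degree_C hc, smul_zero]

theorem normDegree_const_le (c : F) : normDegree (const E c) ≤ 0 := by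
  rcases eq_or_ne c 0 with rfl | hc
  · simp
  · exact (normDegree_const hc).le

theorem normDegree_const_mul_le (c : F) (f : E.CoordinateRing) :
    normDegree (const E c * f) ≤ normDegree f := by
  rw [normDegree_mul]
  simpa using add_le_add_left (normDegree_const_le (E := E) c) (normDegree f)

theorem normDegree_smul_le (c : F) (f : E.CoordinateRing) :
    normDegree (c • f) ≤ normDegree f :=
  smul_eq_const_mul c f ▸ normDegree_const_mul_le c f

theorem normDegree_xCoord : normDegree (xCoord E) = 2 := by
  refine (normDegree_mk_C X).trans ?_
  rw [degree_X]; rfl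

theorem normDegree_yCoord : normDegree (yCoord E) = 3 := by
  have := normDegree_smul_basis (E := E) 0 1
  rw [zero_smul, zero_add, one_smul, degree_zero, degree_one] at this
  exact this.trans (by rw [smul_zero, zero_add]; exact max_bot_left _)

theorem normDegree_xCoord_sub (c : F) : normDegree (xCoord E - const E c) = 2 := by
  have h : xCoord E - const E c = CoordinateRing.mk E (C (X - C c)) := by
    rw [C_sub, map_sub]; rfl
  rw [h, normDegree_mk_C, degree_X_sub_C]; rfl

theorem exists_eq_const_of_normDegree_le {f : E.CoordinateRing} (hf : normDegree f ≤ 0) :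
    ∃ c, f = const E c := by
  obtain ⟨p, q, rfl⟩ := CoordinateRing.exists_smul_basis_eq f
  rw [normDegree_smul_basis, max_le_iff] at hf
  have hq : q = 0 := by
    by_contra hq
    have := hf.2
    rw [degree_eq_natDegree hq, two_nsmul_coe] at this
    norm_cast at this
  have hp : p.degree ≤ 0 := by
    rcases eq_or_ne p 0 with rfl | hp
    · simp
    · have := hf.1
      rw [degree_eq_natDegree hp, two_nsmul_coe] at this
      rw [degree_eq_natDegree hp]
      norm_cast at this ⊢
      omega
  refine ⟨p.coeff 0, ?_⟩
  rw [hq, zero_smul, add_zero, eq_C_of_degree_le_zero hp, CoordinateRing.smul, mul_one]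
  simp [const]

theorem normDegree_mul_lt {f g : E.CoordinateRing} {m n : ℕ} (hf : normDegree f < m)
    (hg : normDegree g ≤ n) : normDegree (f * g) < (m + n : ℕ) := by
  rw [normDegree_mul]
  rcases h1 : normDegree f with _ | a <;> rcases h2 : normDegree g with _ | b
  · exact WithBot.bot_lt_coe _
  · exact WithBot.bot_lt_coe _
  · exact WithBot.bot_lt_coe _
  · rw [h1] at hf; rw [h2] at hg
    change ((a : ℕ) : WithBot ℕ) + ((b : ℕ) : WithBot ℕ) < _
    change ((a : ℕ) : WithBot ℕ) < _ at hf
    change ((b : ℕ) : WithBot ℕ) ≤ _ at hg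
    norm_cast at *
    omega

/-- If `f g` has smaller degree than `n + deg g` then `f` has degree less than `n`. -/
theorem normDegree_lt_of_mul_lt {f g : E.CoordinateRing} {m n : ℕ} (hg : normDegree g = n)
    (h : normDegree (f * g) < (m + n : ℕ)) : normDegree f < m := by
  rw [normDegree_mul, hg] at h
  rcases h1 : normDegree f with _ | a
  · exact WithBot.bot_lt_coe _
  · rw [h1] at h
    change ((a : ℕ) : WithBot ℕ) + _ < _ at h
    change ((a : ℕ) : WithBot ℕ) < _
    norm_cast at *
    omega

theorem normDegree_pow {f : E.CoordinateRing} {m : ℕ} (hf : normDegree f = m) (n : ℕ) :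
    normDegree (f ^ n) = (m * n : ℕ) := by
  induction n with
  | zero => simpa using normDegree_const (E := E) one_ne_zero
  | succ n ih => rw [pow_succ, normDegree_mul, ih, hf]; norm_cast

/-- The product `f * conj f` is the norm of `f`, whose pole order is twice its degree as a
polynomial in `x`; one copy of `normDegree f` cancels. -/
theorem normDegree_conj (f : E.CoordinateRing) : normDegree (conj f) = normDegree f := by
  rcases eq_or_ne f 0 with rfl | hf
  · simp
  have h := congrArg normDegree (mul_conj f)
  rw [normDegree_mul, normDegree_mk_C, two_nsmul] at h
  change normDegree f + _ = normDegree f + normDegree f at h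
  have h0 : normDegree f ≠ ⊥ := fun h => hf (normDegree_eq_bot.mp h)
  exact WithBot.add_left_cancel h0 h

theorem IsNormalizedWithZeros.normDegree {s : Multiset E.Point} {f : E.CoordinateRing}
    (hf : IsNormalizedWithZeros s f) :
    EllipticDivision.normDegree f = ((s.map affineCount).sum : ℕ) :=
  degree_norm_of_span_eq hf.span_eq

/-- Distinct monomials `x ^ i`, `x ^ j y` have distinct pole orders, and the one of order `n` has
coefficient `1` in both functions, so it cancels. -/
theorem IsMonicAtInfinity.normDegree_sub_lt {n : ℕ} {f g : E.CoordinateRing}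
    (hf : IsMonicAtInfinity n f) (hg : IsMonicAtInfinity n g) : normDegree (f - g) < n := by
  obtain ⟨p, q, rfl, hp, hq, h1⟩ := hf
  obtain ⟨p', q', rfl, hp', hq', h1'⟩ := hg
  rw [add_sub_add_comm, ← sub_smul, ← sub_smul, normDegree_smul_basis, max_lt_iff]
  constructor
  · rcases eq_or_ne (p - p') 0 with h | h
    · rw [h]; exact WithBot.bot_lt_coe _
    have h2 := leadingCoeff_ne_zero.mpr h
    rw [leadingCoeff, coeff_sub] at h2
    rw [degree_eq_natDegree h, two_nsmul_coe]
    generalize (p - p').natDegree = d at *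
    norm_cast
    have h3 : 2 * d ≤ n := by
      by_contra h3
      refine h2 ?_
      rw [not_imp_comm.mp (hp d) h3, not_imp_comm.mp (hp' d) h3, sub_zero]
    refine lt_of_le_of_ne h3 ?_
    rintro rfl
    simp only [even_two, Even.mul_right, if_true, Nat.mul_div_cancel_left _ two_pos] at h1 h1'
    exact h2 (by rw [h1, h1', sub_self])
  · rcases eq_or_ne (q - q') 0 with h | h
    · rw [h]; exact WithBot.bot_lt_coe _
    have h2 := leadingCoeff_ne_zero.mpr h
    rw [leadingCoeff, coeff_sub] at h2
    rw [degree_eq_natDegree h, two_nsmul_coe]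
    generalize (q - q').natDegree = d at *
    norm_cast
    have h3 : 2 * d + 3 ≤ n := by
      by_contra h3
      refine h2 ?_
      rw [not_imp_comm.mp (hq d) h3, not_imp_comm.mp (hq' d) h3, sub_zero]
    refine lt_of_le_of_ne h3 ?_
    rintro rfl
    have h4 : ¬ Even (2 * d + 3) := by rw [Nat.not_even_iff]; omega
    rw [if_neg h4, Nat.add_sub_cancel, Nat.mul_div_cancel_left _ two_pos] at h1 h1'
    exact h2 (by rw [h1, h1', sub_self])

theorem value_conj (f : E.CoordinateRing) (P : E.Point) : value (conj f) P = value f (-P) := by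
  rcases P with _ | ⟨x, y, h⟩
  · rfl
  · rw [Point.neg_some]
    induction f using induction_coordinateRing with
    | hc c =>
      rw [value_const _ (Point.some_ne_zero _)]
      have : conj (const E c) = const E c := by
        change AdjoinRoot.lift _ _ _ (AdjoinRoot.mk _ _) = _
        rw [AdjoinRoot.lift_mk]
        exact eval₂_C _ _
      rw [this, value_const _ (Point.some_ne_zero _)]
    | hx =>
      have : conj (xCoord E) = xCoord E := by
        change AdjoinRoot.lift _ _ _ (AdjoinRoot.mk _ _) = _
        rw [AdjoinRoot.lift_mk, eval₂_C]
        rfl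
      rw [this, value_xCoord, value_xCoord]
    | hy =>
      have : conj (yCoord E) = CoordinateRing.mk E E.negPolynomial := by
        change AdjoinRoot.lift _ _ _ (AdjoinRoot.mk _ _) = _
        rw [AdjoinRoot.lift_mk, eval₂_X]
      rw [this, value_yCoord, value_mk, evalEval_negPolynomial]
    | hadd f g hf hg => rw [map_add, value_add, value_add, hf, hg]
    | hmul f g hf hg => rw [map_mul, value_mul, value_mul, hf, hg]

/-- A product of the values at two opposite points is a value of the norm. -/
theorem value_mul_value_neg (f : E.CoordinateRing) {x y : F} (h : E.Nonsingular x y) :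
    value f (.some x y h) * value f (-.some x y h) = (Algebra.norm F[X] f).eval x := by
  rw [← value_conj, ← value_mul, mul_conj, value_mk, evalEval_C]

/-- A nonzero polynomial function has at most as many zeros as its degree. -/
theorem card_zeros_le {f : E.CoordinateRing} (hf : f ≠ 0) (S : Finset E.Point)
    (hS : ∀ P ∈ S, P ≠ 0 ∧ value f P = 0) : (S.card : WithBot ℕ) ≤ normDegree f := by
  classical
  have hN : Algebra.norm F[X] f ≠ 0 := fun h => hf (normDegree_eq_bot.mp (degree_eq_bot.mpr h))
  let xOf : E.Point → F := fun P => match P with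
    | .zero => 0
    | .some x _ _ => x
  rw [normDegree, degree_eq_natDegree hN]
  norm_cast
  refine le_trans ?_ (card_roots' (Algebra.norm F[X] f))
  -- Zeros are counted by abscissa: over each `x` there are at most as many as the multiplicity of
  -- `x` as a root of the norm.
  rw [Finset.card_eq_sum_card_image xOf S]
  refine le_trans (Finset.sum_le_sum (g := fun x => (Algebra.norm F[X] f).roots.count x) ?_) ?_
  · intro x hx
    obtain ⟨P, hP, rfl⟩ := Finset.mem_image.mp hx
    obtain ⟨hP0, hPf⟩ := hS P hP
    obtain ⟨x, y, h, rfl⟩ := (ne_zero_iff_exists_some P).mp hP0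
    change (Finset.filter (fun Q => xOf Q = x) S).card ≤ Multiset.count x _
    rw [count_roots]
    have hroot : (Algebra.norm F[X] f).eval x = 0 := by
      rw [← value_mul_value_neg f h, hPf, zero_mul]
    have hsub : Finset.filter (fun Q => xOf Q = x) S ⊆ {Point.some x y h, -Point.some x y h} := by
      intro Q hQ
      obtain ⟨hQ, hQx⟩ := Finset.mem_filter.mp hQ
      obtain ⟨x', y', h', rfl⟩ := (ne_zero_iff_exists_some Q).mp (hS Q hQ).1
      change x' = x at hQx
      subst hQx
      rw [Finset.mem_insert, Finset.mem_singleton, Point.neg_some]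
      rcases Y_eq_of_X_eq h'.1 h.1 rfl with h2 | h2
      · left; subst h2; rfl
      · right; subst h2; rfl
    by_cases hone : (Finset.filter (fun Q => xOf Q = x) S).card ≤ 1
    · exact hone.trans ((rootMultiplicity_pos hN).mpr hroot)
    · have h2 : (Finset.filter (fun Q => xOf Q = x) S).card ≤ 2 :=
        (Finset.card_le_card hsub).trans Finset.card_le_two
      refine h2.trans ((le_rootMultiplicity_iff hN).mpr ?_)
      have heq := Finset.eq_of_subset_of_card_le hsub
        (Finset.card_le_two.trans (Nat.lt_of_not_le hone))
      have hneg : -Point.some x y h ∈ S := by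
        refine Finset.mem_of_mem_filter (-Point.some x y h) (p := fun Q => xOf Q = x) ?_
        rw [heq]; simp
      have hne : y ≠ E.negY x y := by
        intro hy
        refine hone ?_
        rw [heq, Point.neg_some]
        simp only [← hy, Finset.pair_eq_singleton, Finset.card_singleton, le_refl]
      -- If `p + q y` vanishes at two distinct opposite points over `x`, then both `p` and `q`
      -- vanish at `x`, so the norm is divisible by `(X - x) ^ 2`.
      obtain ⟨p, q, rfl⟩ := CoordinateRing.exists_smul_basis_eq f
      have e1 := hPf
      have e2 := (hS _ hneg).2
      rw [Point.neg_some] at e2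
      rw [value_smul_basis] at e1 e2
      have hq : q.eval x = 0 := by
        have : q.eval x * (y - E.negY x y) = 0 := by linear_combination e1 - e2
        exact (mul_eq_zero.mp this).resolve_right (sub_ne_zero.mpr hne)
      rw [hq, zero_mul, add_zero] at e1
      obtain ⟨p, rfl⟩ := dvd_iff_isRoot.mpr e1
      obtain ⟨q, rfl⟩ := dvd_iff_isRoot.mpr hq
      rw [CoordinateRing.norm_smul_basis]
      exact ⟨p ^ 2 - p * q * (C E.a₁ * X + C E.a₃) -
        q ^ 2 * (X ^ 3 + C E.a₂ * X ^ 2 + C E.a₄ * X + C E.a₆), by ring⟩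
  · rw [← Multiset.sum_count_eq_card (s := S.image xOf ∪ (Algebra.norm F[X] f).roots.toFinset)
      fun a ha => Finset.mem_union_right _ (Multiset.mem_toFinset.mpr ha)]
    exact Finset.sum_le_sum_of_subset Finset.subset_union_left

end Degree

/-! ### Points over an algebraically closed field -/

section Infinite

variable {F : Type*} [Field F] [IsAlgClosed F] {E : WeierstrassCurve.Affine F} [E.IsElliptic]
  [E.IsShortNF]

theorem exists_point_with_x (E : WeierstrassCurve.Affine F) [E.IsElliptic] [E.IsShortNF] (x : F) :
    ∃ y, E.Nonsingular x y := by
  obtain ⟨y, hy⟩ := IsAlgClosed.exists_pow_nat_eq (x ^ 3 + E.a₄ * x + E.a₆) two_pos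
  refine ⟨y, equation_iff_nonsingular.mp ?_⟩
  rw [equation_iff]
  simp [hy]

instance infinite_point : Infinite E.Point := by
  choose y hy using exists_point_with_x E
  refine Infinite.of_injective (fun x => Point.some x (y x) (hy x)) fun a b h => ?_
  simpa using (Point.some.inj h).1

/-- A nonzero difference would have finitely many zeros, whereas the curve has infinitely many
points. Identities between functions may thus be checked away from the poles of the translates
involved. -/
theorem eq_of_value_eq {f g : E.CoordinateRing} {S : Set E.Point} (hS : S.Finite)
    (h : ∀ P, P ∉ S → value f P = value g P) : f = g := by
  rw [← sub_eq_zero]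
  by_contra hfg
  obtain ⟨n, hn⟩ : ∃ n : ℕ, normDegree (f - g) = n := by
    rcases h1 : normDegree (f - g) with _ | n
    · exact absurd (normDegree_eq_bot.mp h1) hfg
    · exact ⟨n, rfl⟩
  have hinf : (insert 0 S : Set E.Point)ᶜ.Infinite := (hS.insert 0).infinite_compl
  obtain ⟨T, hT, hTn⟩ := hinf.exists_subset_card_eq (n + 1)
  have := card_zeros_le hfg T fun P hP => by
    have := hT hP
    rw [Set.mem_compl_iff, Set.mem_insert_iff, not_or] at this
    exact ⟨this.1, by rw [value_sub, h P this.2, sub_self]⟩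
  rw [hTn, hn] at this
  norm_cast at this
  omega

/-- The norm has a root `x`, and its value there is the product of the values of `f` at two opposite
points over `x`. -/
theorem exists_zero_of_normDegree_pos {f : E.CoordinateRing} (hf : 0 < normDegree f) :
    ∃ P : E.Point, P ≠ 0 ∧ value f P = 0 := by
  obtain ⟨x, hx⟩ := IsAlgClosed.exists_root (Algebra.norm F[X] f) hf.ne'
  obtain ⟨y, h⟩ := exists_point_with_x E x
  rw [IsRoot, ← value_mul_value_neg f h, mul_eq_zero] at hx
  rcases hx with hx | hx
  · exact ⟨_, Point.some_ne_zero h, hx⟩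
  · refine ⟨_, ?_, hx⟩
    rw [Point.neg_some]
    exact Point.some_ne_zero _

end Infinite

/-! ### Zeros and poles of translated functions at finite points -/

section Translation

variable {F : Type*} [Field F] {E : WeierstrassCurve.Affine F}

/-- Off `0` and `C`, multiplication by the function `r` on points maps the ideal `I` into `J`. -/
def Multiplies (C : E.Point) (r : E.Point → F) (I J : Ideal E.CoordinateRing) : Prop :=
  ∀ g ∈ I, ∃ u ∈ J, ∀ X, X ≠ 0 → X ≠ C → value u X = r X * value g X

namespace Multiplies

variable {C : E.Point} {r s : E.Point → F} {I I' J J' : Ideal E.CoordinateRing}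

theorem mono (h : Multiplies C r I J) (hI : I' ≤ I) (hJ : J ≤ J') : Multiplies C r I' J' := by
  intro g hg
  obtain ⟨u, hu, h⟩ := h g (hI hg)
  exact ⟨u, hJ hu, h⟩

theorem congr (h : Multiplies C r I J) (hrs : ∀ X, X ≠ 0 → X ≠ C → r X = s X) :
    Multiplies C s I J := by
  intro g hg
  obtain ⟨u, hu, h⟩ := h g hg
  exact ⟨u, hu, fun X h0 hC => by rw [h X h0 hC, hrs X h0 hC]⟩

theorem add (hr : Multiplies C r I J) (hs : Multiplies C s I J) :
    Multiplies C (fun X => r X + s X) I J := by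
  intro g hg
  obtain ⟨u, hu, h⟩ := hr g hg
  obtain ⟨v, hv, h'⟩ := hs g hg
  exact ⟨u + v, add_mem hu hv, fun X h0 hC => by
    rw [value_add, h X h0 hC, h' X h0 hC, add_mul]⟩

theorem mul (hr : Multiplies C r I J) (hs : Multiplies C s I' J') :
    Multiplies C (fun X => r X * s X) (I * I') (J * J') := by
  intro g hg
  induction hg using Submodule.mul_induction_on' with
  | mem_mul_mem a ha b hb =>
    obtain ⟨u, hu, h⟩ := hr a ha
    obtain ⟨v, hv, h'⟩ := hs b hb
    refine ⟨u * v, Ideal.mul_mem_mul hu hv, fun X h0 hC => ?_⟩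
    rw [value_mul, value_mul, h X h0 hC, h' X h0 hC, mul_mul_mul_comm]
  | add a _ b _ ha hb =>
    obtain ⟨u, hu, h⟩ := ha
    obtain ⟨v, hv, h'⟩ := hb
    exact ⟨u + v, add_mem hu hv, fun X h0 hC => by
      rw [value_add, h X h0 hC, h' X h0 hC, value_add, mul_add]⟩

theorem value (f : E.CoordinateRing) : Multiplies C (EllipticDivision.value f) I I := fun g hg =>
  ⟨f * g, Ideal.mul_mem_left _ _ hg, fun X _ _ => value_mul f g X⟩

theorem const (c : F) : Multiplies C (fun _ => c) I I :=
  (value (EllipticDivision.const E c)).congr fun _ h0 _ => value_const c h0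

theorem const_mul (c : F) (hr : Multiplies C r I J) : Multiplies C (fun X => c * r X) I J := by
  intro g hg
  obtain ⟨u, hu, h⟩ := hr g hg
  exact ⟨c • u, by rw [smul_eq_const_mul]; exact Ideal.mul_mem_left _ _ hu, fun X h0 hC => by
    rw [value_smul, h X h0 hC, mul_assoc]⟩

theorem neg (hr : Multiplies C r I J) : Multiplies C (fun X => -r X) I J :=
  (hr.const_mul (-1)).congr fun _ _ _ => neg_one_mul _

theorem pow (hr : Multiplies C r I J) (n : ℕ) :
    Multiplies C (fun X => r X ^ n) (I ^ n) (J ^ n) := by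
  induction n with
  | zero => simpa using const (C := C) (I := ⊤) 1
  | succ n ih => simpa only [pow_succ] using ih.mul hr

theorem sum {ι : Type*} (t : Finset ι) (R : ι → E.Point → F)
    (hR : ∀ i ∈ t, Multiplies C (R i) I J) : Multiplies C (fun X => ∑ i ∈ t, R i X) I J := by
  classical
  induction t using Finset.induction_on with
  | empty => exact fun g _ => ⟨0, zero_mem _, by simp⟩
  | insert i t hi ih =>
    simp only [Finset.sum_insert hi]
    exact (hR i (by simp)).add (ih fun j hj => hR j (by simp [hj]))

end Multiplies

variable {C : E.Point}

/-- The ideal of `C` is generated by `x - x(C)` and `y - y(C)`, so a function with at most a simple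
pole at `C` is recognized on these two generators. -/
theorem multiplies_pointIdeal {l : E.Point → F} {u v : E.CoordinateRing} (hC : C ≠ 0)
    (h : ∀ X, X ≠ 0 → X ≠ C →
      l X * (value (xCoord E) X - value (xCoord E) C) = value u X ∧
      l X * (value (yCoord E) X - value (yCoord E) C) = value v X) :
    Multiplies C l (pointIdeal C) ⊤ := by
  obtain ⟨x', y', h', rfl⟩ := (ne_zero_iff_exists_some C).mp hC
  simp only [value_xCoord, value_yCoord] at h
  intro g hg
  obtain ⟨a, b, rfl⟩ := Ideal.mem_span_pair.mp hg
  refine ⟨a * u + b * v, trivial, fun X hX hXC => ?_⟩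
  obtain ⟨h1, h2⟩ := h X hX hXC
  obtain ⟨x, y, hxy, rfl⟩ := (ne_zero_iff_exists_some X).mp hX
  simp only [value_add, value_mul, ← h1, ← h2, CoordinateRing.XClass, CoordinateRing.YClass,
    value_mk, value_xCoord, value_yCoord, evalEval_C, evalEval_sub, evalEval_X, eval_sub, eval_X,
    eval_C]
  ring

theorem exists_normDegree_le (f : E.CoordinateRing) : ∃ m : ℕ, normDegree f ≤ m := by
  rcases h : normDegree f with _ | m
  · exact ⟨0, bot_le⟩
  · exact ⟨m, le_rfl⟩

variable [DecidableEq F] [E.IsShortNF]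

/-- The chord and tangent formulas for `X - C`, in terms of the slope of the line through `X`
and `-C`. -/
theorem exists_slope (hC : C ≠ 0) : ∃ l : E.Point → F, ∀ X, X ≠ 0 → X ≠ C →
    l X * (value (xCoord E) X - value (xCoord E) C) = value (yCoord E) X + value (yCoord E) C ∧
    l X * (value (yCoord E) X - value (yCoord E) C) = value (xCoord E) X ^ 2 +
      value (xCoord E) X * value (xCoord E) C + value (xCoord E) C ^ 2 + E.a₄ ∧
    value (xCoord E) (X - C) = l X ^ 2 - value (xCoord E) X - value (xCoord E) C ∧
    value (yCoord E) (X - C) =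
      -(l X * (value (xCoord E) (X - C) - value (xCoord E) X) + value (yCoord E) X) := by
  obtain ⟨x', y', h', rfl⟩ := (ne_zero_iff_exists_some C).mp hC
  suffices ∀ X : E.Point, ∃ l : F, X ≠ 0 → X ≠ .some x' y' h' →
      l * (value (xCoord E) X - x') = value (yCoord E) X + y' ∧
      l * (value (yCoord E) X - y') = value (xCoord E) X ^ 2 +
        value (xCoord E) X * x' + x' ^ 2 + E.a₄ ∧
      value (xCoord E) (X - .some x' y' h') = l ^ 2 - value (xCoord E) X - x' ∧
      value (yCoord E) (X - .some x' y' h') =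
        -(l * (value (xCoord E) (X - .some x' y' h') - value (xCoord E) X) +
          value (yCoord E) X) by
    choose l hl using this
    exact ⟨l, by simpa using hl⟩
  intro X
  rcases X with _ | ⟨x, y, h⟩
  · exact ⟨0, fun h => (h rfl).elim⟩
  have e := (equation_iff _ _).mp h.1
  have e' := (equation_iff _ _).mp h'.1
  simp only [WeierstrassCurve.a₂_of_isShortNF, WeierstrassCurve.a₁_of_isShortNF,
    WeierstrassCurve.a₃_of_isShortNF, zero_mul, add_zero] at e e'
  have hneg : ∀ x y, E.negY x y = -y := fun x y => by simp [negY]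
  refine ⟨E.slope x x' y (E.negY x' y'), fun _ hne => ?_⟩
  have hxy : ¬(x = x' ∧ y = E.negY x' (E.negY x' y')) := by
    rintro ⟨rfl, h2⟩
    rw [negY_negY] at h2
    subst h2
    exact hne rfl
  rw [sub_eq_add_neg (Point.some x y h), Point.neg_some, Point.add_some hxy]
  simp only [value_xCoord, value_yCoord]
  refine ⟨?_, ?_, by simp [addX], by simp [addY, negAddY]⟩
  -- Equal abscissas with `X ≠ C` force `X = -C`; the line is then the tangent there.
  · by_cases hx : x = x'
    · subst hx
      have : y = -y' := by
        rcases Y_eq_of_X_eq h.1 h'.1 rfl with h2 | h2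
        · exact absurd ⟨rfl, by rw [negY_negY]; exact h2⟩ hxy
        · rwa [hneg] at h2
      rw [this]; ring
    · rw [slope_of_X_ne hx, div_mul_cancel₀ _ (sub_ne_zero.mpr hx), hneg, sub_neg_eq_add]
  · by_cases hx : x = x'
    · subst hx
      have hy : y = -y' := by
        rcases Y_eq_of_X_eq h.1 h'.1 rfl with h2 | h2
        · exact absurd ⟨rfl, by rw [negY_negY]; exact h2⟩ hxy
        · rwa [hneg] at h2
      have hne : y ≠ E.negY x (E.negY x y') := fun h2 => hxy ⟨rfl, h2⟩
      have hne' : y - y' ≠ 0 := by rwa [negY_negY, ← sub_ne_zero] at hne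
      rw [slope_of_Y_ne rfl hne, hneg]
      have h2 : y - -y = y - y' := by rw [hy]; ring
      rw [h2, div_mul_cancel₀ _ hne']
      simp
      ring
    · rw [slope_of_X_ne hx, hneg, sub_neg_eq_add, div_mul_eq_mul_div,
        div_eq_iff (sub_ne_zero.mpr hx)]
      linear_combination e - e'

/-- The slope has at most a simple pole at `C`. The addition formulas are quadratic in it for `x(X -
C)` and cubic for `y(X - C)`, which gives the exponents `2` and `3`. -/
theorem multiplies_translates (hC : C ≠ 0) :
    Multiplies C (fun X => value (xCoord E) (X - C)) (pointIdeal C ^ 2) ⊤ ∧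
      Multiplies C (fun X => value (yCoord E) (X - C)) (pointIdeal C ^ 3) ⊤ := by
  obtain ⟨l, hl⟩ := exists_slope hC
  have h1 : Multiplies C l (pointIdeal C) ⊤ := by
    refine multiplies_pointIdeal (u := yCoord E + const E (value (yCoord E) C))
      (v := xCoord E ^ 2 + xCoord E * const E (value (xCoord E) C) +
        const E (value (xCoord E) C) ^ 2 + const E E.a₄) hC fun X hX hXC => ?_
    obtain ⟨e1, e2, -, -⟩ := hl X hX hXC
    rw [e1, e2]
    simp only [value_add, value_mul, value_pow _ _ hX, value_const _ hX, and_self]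
  have h2 : Multiplies C (fun X => value (xCoord E) (X - C)) (pointIdeal C ^ 2) ⊤ := by
    refine (((h1.pow 2).mono le_rfl le_top).add (((Multiplies.value (-xCoord E)).mono le_rfl
      le_top).add ((Multiplies.const (-value (xCoord E) C)).mono le_rfl le_top))).congr
      fun X hX hXC => ?_
    rw [(hl X hX hXC).2.2.1, value_neg]
    ring
  refine ⟨h2, ?_⟩
  have h3 := h1.mul (h2.add ((Multiplies.value (-xCoord E)).mono le_rfl le_top))
  rw [← pow_succ'] at h3
  refine ((h3.mono le_rfl le_top).add ((Multiplies.value (yCoord E)).mono le_rfl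
    le_top)).neg.congr fun X hX hXC => ?_
  rw [(hl X hX hXC).2.2.2, value_neg]
  ring

/-- A function with a pole of order at most `m` at infinity has a translate by `C` with a pole of
order at most `m` at `C`. -/
theorem multiplies_translate (hC : C ≠ 0) {f : E.CoordinateRing} {m : ℕ}
    (hf : normDegree f ≤ m) :
    Multiplies C (fun X => value f (X - C)) (pointIdeal C ^ m) ⊤ := by
  obtain ⟨hx, hy⟩ := multiplies_translates hC
  obtain ⟨p, q, rfl⟩ := CoordinateRing.exists_smul_basis_eq f
  rw [normDegree_smul_basis, max_le_iff] at hf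
  have key : ∀ (p : F[X]) (n : ℕ), 2 • p.degree ≤ n →
      Multiplies C (fun X => p.eval (value (xCoord E) (X - C))) (pointIdeal C ^ n) ⊤ := by
    intro p n hp
    simp only [eval_eq_sum_range]
    refine Multiplies.sum _ _ fun i hi => ?_
    rcases eq_or_ne p 0 with rfl | hp0
    · simp only [coeff_zero, zero_mul]
      exact (Multiplies.const 0).mono le_rfl le_top
    refine Multiplies.const_mul _ ((hx.pow i).mono ?_ le_top)
    rw [← pow_mul]
    refine Ideal.pow_le_pow_right ?_
    rw [degree_eq_natDegree hp0, two_nsmul_coe] at hp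
    norm_cast at hp
    have := Finset.mem_range.mp hi
    omega
  have hq : Multiplies C (fun X => q.eval (value (xCoord E) (X - C)) *
      value (yCoord E) (X - C)) (pointIdeal C ^ m) ⊤ := by
    rcases eq_or_ne q 0 with rfl | hq0
    · simp only [eval_zero, zero_mul]
      exact (Multiplies.const 0).mono le_rfl le_top
    have h1 := hf.2
    rw [degree_eq_natDegree hq0, two_nsmul_coe] at h1
    norm_cast at h1
    refine ((key q (2 * q.natDegree) ?_).mul hy).mono ?_ le_top
    · rw [degree_eq_natDegree hq0, two_nsmul_coe]
    · rw [← pow_add]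
      exact Ideal.pow_le_pow_right h1
  refine ((key p m hf.1).add hq).congr fun X hX hXC => ?_
  obtain ⟨x, y, h, hxy⟩ := (ne_zero_iff_exists_some _).mp (sub_ne_zero.mpr hXC)
  rw [hxy, value_smul_basis, value_xCoord, value_yCoord]

/-- Splitting an element of the `n`-th power into products of functions vanishing at `W` loses
control of the pole at `C`, hence the unspecified `m`. The sharp exponent is recovered in
`multiplies_translate_pow`. -/
theorem exists_multiplies_translate_pow (hC : C ≠ 0) {W : E.Point} (hW : W ≠ 0) (hCW : C + W ≠ 0)
    {f : E.CoordinateRing} {n : ℕ} (hf : f ∈ pointIdeal W ^ n) :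
    ∃ m, Multiplies C (fun X => value f (X - C)) (pointIdeal C ^ m) (pointIdeal (C + W) ^ n) := by
  have hadd : ∀ (n : ℕ) (f g : E.CoordinateRing),
      (∃ m, Multiplies C (fun X => value f (X - C)) (pointIdeal C ^ m) (pointIdeal (C + W) ^ n)) →
      (∃ m, Multiplies C (fun X => value g (X - C)) (pointIdeal C ^ m) (pointIdeal (C + W) ^ n)) →
      ∃ m, Multiplies C (fun X => value (f + g) (X - C)) (pointIdeal C ^ m)
        (pointIdeal (C + W) ^ n) := by
    rintro n f g ⟨m, hm⟩ ⟨m', hm'⟩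
    refine ⟨max m m', ?_⟩
    simp only [value_add]
    exact (hm.mono (Ideal.pow_le_pow_right (le_max_left _ _)) le_rfl).add
      (hm'.mono (Ideal.pow_le_pow_right (le_max_right _ _)) le_rfl)
  induction n generalizing f with
  | zero =>
    obtain ⟨m, hm⟩ := exists_normDegree_le f
    exact ⟨m, by simpa using multiplies_translate hC hm⟩
  | succ n ih =>
    rw [pow_succ] at hf
    induction hf using Submodule.mul_induction_on' with
    | mem_mul_mem a ha b hb =>
      obtain ⟨m, hm⟩ := ih ha
      obtain ⟨m', hm'⟩ := exists_normDegree_le b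
      refine ⟨m + m', ?_⟩
      rw [pow_add, pow_succ]
      have hb' : Multiplies C (fun X => value b (X - C)) (pointIdeal C ^ m')
          (pointIdeal (C + W)) := by
        intro g hg
        obtain ⟨u, -, hu⟩ := multiplies_translate hC hm' g hg
        refine ⟨u, ?_, hu⟩
        rw [mem_pointIdeal_iff _ hCW, hu _ hCW (by simpa using hW)]
        simp only [add_sub_cancel_left, (mem_pointIdeal_iff _ hW).mp hb, zero_mul]
      exact (hm.mul hb').congr fun X _ _ => (value_mul a b (X - C)).symm
    | add a _ b _ ha hb => exact hadd _ _ _ ha hb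

variable [IsAlgClosed F] [E.IsElliptic]

/-- Translation by `C` takes zeros of order `n` at `W` to zeros of order `n` at `C + W`. -/
theorem multiplies_translate_pow (hC : C ≠ 0) {W : E.Point} (hW : W ≠ 0) (hCW : C + W ≠ 0)
    {f : E.CoordinateRing} {m n : ℕ} (hf : f ∈ pointIdeal W ^ n) (hm : normDegree f ≤ m) :
    Multiplies C (fun X => value f (X - C)) (pointIdeal C ^ m) (pointIdeal (C + W) ^ n) := by
  obtain ⟨M, hM⟩ := exists_multiplies_translate_pow hC hW hCW hf
  intro g hg
  obtain ⟨u, -, hu⟩ := multiplies_translate hC hm g hg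
  refine ⟨u, ?_, hu⟩
  -- Write `1 = i + j` with `i` vanishing to order `M` at `C` and `j` to order `n` at `C + W`. Then
  -- `u * i` lies in the target ideal by the weak version, and `u * j` does so trivially.
  have hcop := Ideal.isCoprime_iff_exists.mp (isCoprime_pointIdeal_pow hC hCW
    (by simpa using hW) M n)
  obtain ⟨i, hi, j, hj, hij⟩ := hcop
  obtain ⟨v, hv, hv'⟩ := hM (g * i) (Ideal.mul_mem_left _ _ hi)
  have huv : v = u * i := by
    refine eq_of_value_eq (S := {0, C}) (by simp) fun X hX => ?_
    simp only [Set.mem_insert_iff, Set.mem_singleton_iff, not_or] at hX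
    rw [hv' X hX.1 hX.2, value_mul, value_mul, hu X hX.1 hX.2, mul_assoc]
  have : u = v + u * j := by rw [huv, ← mul_add, hij, mul_one]
  rw [this]
  exact add_mem hv (Ideal.mul_mem_left _ _ hj)

end Translation

/-! ### Behaviour of translated functions at infinity -/

section Infinity

variable {F : Type*} [Field F] {E : WeierstrassCurve.Affine F}

/-- The function `r` on the points agrees, off `0` and `C`, with a rational function
vanishing at infinity whose poles have the same abscissa as `C`. -/
def VanishesAtInfinity (C : E.Point) (r : E.Point → F) : Prop :=
  ∃ (n : ℕ) (a : E.CoordinateRing), normDegree a < (2 * n : ℕ) ∧ ∀ X, X ≠ 0 → X ≠ C →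
    r X * (value (xCoord E) X - value (xCoord E) C) ^ n = value a X

namespace VanishesAtInfinity

variable {C : E.Point} {r s : E.Point → F}

theorem value_sub_pow {X : E.Point} (hX : X ≠ 0) (n : ℕ) :
    value ((xCoord E - EllipticDivision.const E (value (xCoord E) C)) ^ n) X =
      (value (xCoord E) X - value (xCoord E) C) ^ n := by
  rw [value_pow _ _ hX, value_sub, value_const _ hX]

theorem congr (h : VanishesAtInfinity C r) (hrs : ∀ X, X ≠ 0 → X ≠ C → r X = s X) :
    VanishesAtInfinity C s := by
  obtain ⟨n, a, ha, h⟩ := h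
  exact ⟨n, a, ha, fun X h0 hC => by rw [← hrs X h0 hC, h X h0 hC]⟩

theorem add (hr : VanishesAtInfinity C r) (hs : VanishesAtInfinity C s) :
    VanishesAtInfinity C (fun X => r X + s X) := by
  obtain ⟨n, a, ha, h⟩ := hr
  obtain ⟨m, b, hb, h'⟩ := hs
  have hd := fun n => (normDegree_pow (normDegree_xCoord_sub (E := E) (value (xCoord E) C)) n).le
  refine ⟨n + m, a * (xCoord E - EllipticDivision.const E (value (xCoord E) C)) ^ m +
    b * (xCoord E - EllipticDivision.const E (value (xCoord E) C)) ^ n,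
    (normDegree_add_le _ _).trans_lt (max_lt ?_ ?_), fun X h0 hC => ?_⟩
  · exact (normDegree_mul_lt ha (hd m)).trans_eq (by rw [mul_add])
  · exact (normDegree_mul_lt hb (hd n)).trans_eq (by rw [mul_add, add_comm])
  · rw [value_add, value_mul, value_mul, value_sub_pow h0, value_sub_pow h0, ← h X h0 hC,
      ← h' X h0 hC]
    ring

theorem mul (hr : VanishesAtInfinity C r) (hs : VanishesAtInfinity C s) :
    VanishesAtInfinity C (fun X => r X * s X) := by
  obtain ⟨n, a, ha, h⟩ := hr
  obtain ⟨m, b, hb, h'⟩ := hs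
  refine ⟨n + m, a * b, ?_, fun X h0 hC => ?_⟩
  · exact (normDegree_mul_lt ha hb.le).trans_eq (by rw [mul_add])
  · rw [value_mul, ← h X h0 hC, ← h' X h0 hC]
    ring

theorem const_mul (c : F) (hr : VanishesAtInfinity C r) :
    VanishesAtInfinity C (fun X => c * r X) := by
  obtain ⟨n, a, ha, h⟩ := hr
  exact ⟨n, c • a, (normDegree_smul_le c a).trans_lt ha, fun X h0 hC => by
    rw [value_smul, ← h X h0 hC, mul_assoc]⟩

end VanishesAtInfinity

variable [DecidableEq F] [E.IsShortNF] {C : E.Point}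

theorem vanishesAtInfinity_xCoord (hC : C ≠ 0) :
    VanishesAtInfinity C (fun X => value (xCoord E) (X - C) - value (xCoord E) (-C)) := by
  obtain ⟨l, hl⟩ := exists_slope hC
  obtain ⟨x', y', h', rfl⟩ := (ne_zero_iff_exists_some C).mp hC
  -- This is `(y + y') ^ 2 - (x + 2 x') (x - x') ^ 2` reduced by the equation of the curve. The `x ^
  -- 3` terms cancel, leaving pole order at most `3 < 4`.
  refine ⟨2, const E (2 * y') * yCoord E + (const E (3 * x' ^ 2 + E.a₄) * xCoord E +
    const E (E.a₆ + y' ^ 2 - 2 * x' ^ 3)), ?_, fun X h0 hXC => ?_⟩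
  · refine (normDegree_add_le _ _).trans_lt (max_lt ?_ ((normDegree_add_le _ _).trans_lt
      (max_lt ?_ ?_)))
    · refine (normDegree_const_mul_le _ _).trans_lt ?_
      rw [normDegree_yCoord]; norm_cast
    · refine (normDegree_const_mul_le _ _).trans_lt ?_
      rw [normDegree_xCoord]; norm_cast
    · refine (normDegree_const_le _).trans_lt ?_
      norm_cast
  · obtain ⟨e1, e2, e3, e4⟩ := hl X h0 hXC
    obtain ⟨x, y, h, rfl⟩ := (ne_zero_iff_exists_some X).mp h0
    have e := (equation_iff _ _).mp h.1
    simp only [WeierstrassCurve.a₂_of_isShortNF, WeierstrassCurve.a₁_of_isShortNF,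
      WeierstrassCurve.a₃_of_isShortNF, zero_mul, add_zero] at e
    simp only [e3, Point.neg_some, value_xCoord, value_yCoord, value_add, value_mul, value_const _ h0]
    simp only [value_xCoord, value_yCoord] at e1
    generalize l (Point.some x y h) = l at *
    linear_combination (l * (x - x') + y + y') * e1 + e

theorem vanishesAtInfinity_yCoord (hC : C ≠ 0) :
    VanishesAtInfinity C (fun X => value (yCoord E) (X - C) - value (yCoord E) (-C)) := by
  obtain ⟨l, hl⟩ := exists_slope hC
  obtain ⟨x', y', h', rfl⟩ := (ne_zero_iff_exists_some C).mp hC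
  -- The analogous expansion of `(y(X - C) + y') (x - x') ^ 3`, where `y(-C) = -y'`. The terms in `x
  -- ^ 3 y`, `x ^ 2 y` and `x ^ 3` cancel, leaving pole order at most `5 < 6`.
  refine ⟨3, const E (-6 * y' * x') * (xCoord E * xCoord E) +
    (const E (2 * y' * (3 * x' ^ 2 - E.a₄) - y' * (3 * x' ^ 2 + E.a₄)) * xCoord E +
    (const E (2 * y' * (-x' ^ 3 - E.a₆) - y' * (E.a₆ + y' ^ 2 - 2 * x' ^ 3)) +
    (const E (-(3 * x' ^ 2 + E.a₄)) * (xCoord E * yCoord E) +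
    const E (-(E.a₆ + y' ^ 2 - 2 * x' ^ 3) - 2 * y' ^ 2) * yCoord E))), ?_, fun X h0 hXC => ?_⟩
  · have hlt : ∀ (c : F) (f : E.CoordinateRing), normDegree f < (2 * 3 : ℕ) →
        normDegree (const E c * f) < (2 * 3 : ℕ) :=
      fun c f hf => (normDegree_const_mul_le _ _).trans_lt hf
    refine (normDegree_add_le _ _).trans_lt (max_lt (hlt _ _ ?_) ((normDegree_add_le _ _).trans_lt
      (max_lt (hlt _ _ ?_) ((normDegree_add_le _ _).trans_lt (max_lt ?_
      ((normDegree_add_le _ _).trans_lt (max_lt (hlt _ _ ?_) (hlt _ _ ?_))))))))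
    · rw [normDegree_mul, normDegree_xCoord]; norm_cast
    · rw [normDegree_xCoord]; norm_cast
    · refine (normDegree_const_le _).trans_lt ?_
      norm_cast
    · rw [normDegree_mul, normDegree_xCoord, normDegree_yCoord]; norm_cast
    · rw [normDegree_yCoord]; norm_cast
  · obtain ⟨e1, e2, e3, e4⟩ := hl X h0 hXC
    obtain ⟨x, y, h, rfl⟩ := (ne_zero_iff_exists_some X).mp h0
    have e := (equation_iff _ _).mp h.1
    simp only [WeierstrassCurve.a₂_of_isShortNF, WeierstrassCurve.a₁_of_isShortNF,
      WeierstrassCurve.a₃_of_isShortNF, zero_mul, add_zero] at e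
    have hneg : E.negY x' y' = -y' := by simp [negY]
    simp only [e4, e3, Point.neg_some, value_xCoord, value_yCoord, value_add, value_mul,
      value_const _ h0, hneg]
    simp only [value_xCoord, value_yCoord] at e1
    generalize l (Point.some x y h) = l at *
    linear_combination ((2 * x + x') * (x - x') ^ 2 - ((l * (x - x')) ^ 2 +
      l * (x - x') * (y + y') + (y + y') ^ 2)) * e1 + (-y - 3 * y') * e

/-- A polynomial function translated by `C` takes its value at `-C` at infinity. -/
theorem vanishesAtInfinity_translate (hC : C ≠ 0) (f : E.CoordinateRing) :
    VanishesAtInfinity C (fun X => value f (X - C) - value f (-C)) := by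
  induction f using induction_coordinateRing with
  | hc c =>
    refine ⟨0, 0, by rw [normDegree_zero]; exact WithBot.bot_lt_coe _, fun X _ hXC => ?_⟩
    simp [value_const _ (sub_ne_zero.mpr hXC), value_const _ (neg_ne_zero.mpr hC)]
  | hx => exact vanishesAtInfinity_xCoord hC
  | hy => exact vanishesAtInfinity_yCoord hC
  | hadd f g hf hg =>
    refine (hf.add hg).congr fun X _ _ => ?_
    rw [value_add, value_add]
    ring
  | hmul f g hf hg =>
    -- With `Δ` the difference from the value at `-C`: `Δ(f g) = Δf Δg + f(-C) Δg + g(-C) Δf`.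
    refine ((hf.mul hg).add ((hg.const_mul (value f (-C))).add
      (hf.const_mul (value g (-C))))).congr fun X _ _ => ?_
    rw [value_mul, value_mul]
    ring

variable [IsAlgClosed F] [E.IsElliptic]

/-- The difference equals `(f(X - C) - f(-C)) g(X)`, whose first factor vanishes at infinity. So the
coefficient of order `n` of `u` is `f(-C)` times that of `g`, which later fixes constants. -/
theorem normDegree_sub_lt_of_translate (hC : C ≠ 0) {f g u : E.CoordinateRing} {n : ℕ}
    (hg : normDegree g ≤ n)
    (hu : ∀ X, X ≠ 0 → X ≠ C → value u X = value f (X - C) * value g X) :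
    normDegree (u - value f (-C) • g) < n := by
  obtain ⟨m, a, ha, h⟩ := vanishesAtInfinity_translate hC f
  have hd := normDegree_pow (normDegree_xCoord_sub (E := E) (value (xCoord E) C)) m
  refine normDegree_lt_of_mul_lt hd ?_
  have : (u - value f (-C) • g) * (xCoord E - const E (value (xCoord E) C)) ^ m = a * g := by
    refine eq_of_value_eq (S := {0, C}) (by simp) fun X hX => ?_
    simp only [Set.mem_insert_iff, Set.mem_singleton_iff, not_or] at hX
    rw [value_mul, value_mul, ← h X hX.1 hX.2, VanishesAtInfinity.value_sub_pow hX.1, value_sub,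
      value_smul, hu X hX.1 hX.2]
    ring
  rw [this]
  exact (normDegree_mul_lt ha hg).trans_eq (by rw [add_comm])

end Infinity

/-! ### The functions `h_W` and `g_P` -/

section Functions

variable {F : Type*} [Field F] {E : WeierstrassCurve.Affine F}

theorem affineCount_of_ne_zero {P : E.Point} (hP : P ≠ 0) : affineCount P = 1 := by
  obtain ⟨x, y, h, rfl⟩ := (ne_zero_iff_exists_some P).mp hP
  rfl

theorem conj_mem_pointIdeal_neg_pow {P : E.Point} (hP : P ≠ 0) {f : E.CoordinateRing} {n : ℕ}
    (hf : f ∈ pointIdeal P ^ n) : conj f ∈ pointIdeal (-P) ^ n := by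
  have hP' : -P ≠ 0 := by
    obtain ⟨x, y, h, rfl⟩ := (ne_zero_iff_exists_some P).mp hP
    exact Point.some_ne_zero _
  have h : (pointIdeal P).map conj ≤ pointIdeal (-P) := by
    rw [Ideal.map_le_iff_le_comap]
    intro g hg
    rw [Ideal.mem_comap, mem_pointIdeal_iff _ hP', value_conj, neg_neg]
    exact (mem_pointIdeal_iff _ hP).mp hg
  have := Ideal.mem_map_of_mem conj hf
  rw [Ideal.map_pow] at this
  exact Ideal.pow_right_mono h n this

/-- Pole orders add, so `r` has no pole at infinity. Combined with divisibility by the generator of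
an ideal, this replaces the principle that a divisor determines its function up to a constant. -/
theorem exists_eq_const_of_normDegree_mul_le {r g : E.CoordinateRing} {n : ℕ}
    (hg : normDegree g = n) (h : normDegree (r * g) ≤ n) : ∃ c, r = const E c := by
  have hr : normDegree r < (1 : ℕ) :=
    normDegree_lt_of_mul_lt hg (h.trans_lt (by norm_cast; omega))
  refine exists_eq_const_of_normDegree_le ?_
  rcases h : normDegree r with _ | m
  · exact bot_le
  · rw [h] at hr
    change ((m : ℕ) : WithBot ℕ) < _ at hr
    change ((m : ℕ) : WithBot ℕ) ≤ _
    norm_cast at *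
    omega

variable [DecidableEq F] {ℓ : ℕ} {P Q V W : E.Point}

theorem millerFunction_spec (hW : ℓ • W = 0) :
    IsNormalizedWithZeros (Multiset.replicate ℓ W) (millerFunction ℓ W) :=
  normalizedFunction_spec (by rw [Multiset.sum_replicate, hW])

theorem divisionFunction_spec (hP : ℓ • P = Q) :
    IsNormalizedWithZeros (Multiset.replicate ℓ P + {-Q}) (divisionFunction ℓ Q P) :=
  normalizedFunction_spec (by
    rw [Multiset.sum_add, Multiset.sum_replicate, hP, Multiset.sum_singleton, add_neg_cancel])

theorem span_millerFunction (hW : ℓ • W = 0) :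
    Ideal.span {millerFunction ℓ W} = pointIdeal W ^ ℓ := by
  rw [(millerFunction_spec hW).span_eq, Multiset.map_replicate, Multiset.prod_replicate]

theorem span_divisionFunction (hP : ℓ • P = Q) :
    Ideal.span {divisionFunction ℓ Q P} = pointIdeal P ^ ℓ * pointIdeal (-Q) := by
  rw [(divisionFunction_spec hP).span_eq, Multiset.map_add, Multiset.prod_add,
    Multiset.map_replicate, Multiset.prod_replicate, Multiset.map_singleton,
    Multiset.prod_singleton]

theorem normDegree_millerFunction (hW : ℓ • W = 0) (hW0 : W ≠ 0) :
    normDegree (millerFunction ℓ W) = ℓ := by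
  rw [(millerFunction_spec hW).normDegree, Multiset.map_replicate, Multiset.sum_replicate,
    affineCount_of_ne_zero hW0]
  simp

theorem value_millerFunction_ne_zero (hW : ℓ • W = 0) (hP : P ≠ 0) (hPW : P ≠ W) :
    value (millerFunction ℓ W) P ≠ 0 := by
  rw [Ne, (millerFunction_spec hW).value_eq_zero_iff hP]
  exact fun h => hPW (Multiset.eq_of_mem_replicate h)

theorem sum_affineCount_division (hP0 : P ≠ 0) (hQ0 : Q ≠ 0) :
    ((Multiset.replicate ℓ P + {-Q}).map affineCount).sum = ℓ + 1 := by
  rw [Multiset.map_add, Multiset.sum_add, Multiset.map_replicate, Multiset.sum_replicate,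
    Multiset.map_singleton, Multiset.sum_singleton, affineCount_of_ne_zero hP0,
    affineCount_of_ne_zero (neg_ne_zero.mpr hQ0), smul_eq_mul, mul_one]

theorem value_divisionFunction_ne_zero (hP : ℓ • P = Q) (hV : V ≠ 0) (hVP : V ≠ P)
    (hVQ : Q ≠ -V) : value (divisionFunction ℓ Q P) V ≠ 0 := by
  rw [Ne, (divisionFunction_spec hP).value_eq_zero_iff hV, Multiset.mem_add, not_or,
    Multiset.mem_singleton]
  exact ⟨fun h => hVP (Multiset.eq_of_mem_replicate h), fun h => hVQ (by rw [h, neg_neg])⟩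

end Functions

/-! ### The commutator constant and its action on `G_V` -/

section Pairing

variable {F : Type*} [Field F] [DecidableEq F] [IsAlgClosed F] {E : WeierstrassCurve.Affine F}
  [E.IsElliptic] [E.IsShortNF] {ℓ : ℕ} {P Q V W : E.Point}

theorem normDegree_le_of_translate {C : E.Point} (hC : C ≠ 0) {f g u : E.CoordinateRing} {n : ℕ}
    (hg : normDegree g ≤ n)
    (hu : ∀ X, X ≠ 0 → X ≠ C → value u X = value f (X - C) * value g X) :
    normDegree u ≤ n := by
  rw [← sub_add_cancel u (value f (-C) • g)]
  exact (normDegree_add_le _ _).trans (max_le (normDegree_sub_lt_of_translate hC hg hu).le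
    ((normDegree_smul_le _ _).trans hg))

/-- The pole of order `ℓ` of `h_W(X - V)` at `V` is cancelled by `h_V`, and its zero of order `ℓ`
lies at `V + W`; the product is divisible by `h_{V+W}`, with a quotient of degree zero. -/
theorem exists_value_translate_millerFunction_mul (hV : ℓ • V = 0) (hW : ℓ • W = 0) (hV0 : V ≠ 0)
    (hW0 : W ≠ 0) (hVW : V + W ≠ 0) : ∃ c, ∀ X, X ≠ 0 → X ≠ V →
      value (millerFunction ℓ W) (X - V) * value (millerFunction ℓ V) X =
        c * value (millerFunction ℓ (V + W)) X := by
  have hVW' : ℓ • (V + W) = 0 := by rw [nsmul_add, hV, hW, add_zero]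
  obtain ⟨u, hu, h⟩ := multiplies_translate_pow hV0 hW0 hVW
    ((Ideal.span_singleton_le_iff_mem _).mp (span_millerFunction hW).le)
    (normDegree_millerFunction hW hW0).le (millerFunction ℓ V)
    ((Ideal.span_singleton_le_iff_mem _).mp (span_millerFunction hV).le)
  rw [← span_millerFunction hVW', Ideal.mem_span_singleton'] at hu
  obtain ⟨r, rfl⟩ := hu
  have hdeg := normDegree_le_of_translate hV0 (normDegree_millerFunction hV hV0).le h
  obtain ⟨c, rfl⟩ :=
    exists_eq_const_of_normDegree_mul_le (normDegree_millerFunction hVW' hVW) hdeg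
  exact ⟨c, fun X h0 hX => by rw [← h X h0 hX, value_mul, value_const _ h0]⟩

/-- The commutator of the translations by `V` and `W` is a constant. -/
theorem exists_commutator (hV : ℓ • V = 0) (hW : ℓ • W = 0) (hV0 : V ≠ 0)
    (hW0 : W ≠ 0) (hVW : V + W ≠ 0) : ∃ ε, ∀ X, X ≠ 0 → X ≠ V → X ≠ W →
      value (millerFunction ℓ V) (X - W) * value (millerFunction ℓ W) X =
        ε * (value (millerFunction ℓ W) (X - V) * value (millerFunction ℓ V) X) := by
  obtain ⟨c, hc⟩ := exists_value_translate_millerFunction_mul hV hW hV0 hW0 hVW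
  obtain ⟨d, hd⟩ := exists_value_translate_millerFunction_mul hW hV hW0 hV0 (add_comm V W ▸ hVW)
  -- Otherwise the product of two nonzero functions would vanish at a point `X` other than `0`, `V`
  -- and `V + W`, where neither factor is zero.
  have hc0 : c ≠ 0 := by
    rintro rfl
    obtain ⟨X, hX⟩ := (Set.toFinite {0, V, V + W} : Set.Finite _).exists_notMem
    simp only [Set.mem_insert_iff, Set.mem_singleton_iff, not_or] at hX
    have := hc X hX.1 hX.2.1
    rw [zero_mul, mul_eq_zero] at this
    rcases this with h | h
    · exact value_millerFunction_ne_zero hW (sub_ne_zero.mpr hX.2.1)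
        (fun h => hX.2.2 (by rw [← h, add_sub_cancel])) h
    · exact value_millerFunction_ne_zero hV hX.1 hX.2.1 h
  refine ⟨d / c, fun X h0 hXV hXW => ?_⟩
  rw [hd X h0 hXW, hc X h0 hXV, add_comm W V, ← mul_assoc, div_mul_cancel₀ _ hc0]

/-- As a function of `X`, `h_W(P + W - X)` has divisor `ℓ P - ℓ(P + W)` and tends to `h_W(P + W)` at
infinity. Multiplication by it turns the divisor of `g_{P+W}` into that of `g_P`, and normalization
determines the constant. -/
theorem value_divisionFunction_mul (hP : ℓ • P = Q) (hQ : Q ≠ 0) (hW : ℓ • W = 0) (hW0 : W ≠ 0)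
    {X : E.Point} (hX : X ≠ 0) (hXP : X ≠ P + W) :
    value (divisionFunction ℓ Q (P + W)) X * value (millerFunction ℓ W) (P + W - X) =
      value (millerFunction ℓ W) (P + W) * value (divisionFunction ℓ Q P) X := by
  have hPW : ℓ • (P + W) = Q := by rw [nsmul_add, hP, hW, add_zero]
  have hP0 : P ≠ 0 := by rintro rfl; exact hQ (by rw [← hP, nsmul_zero])
  have hPW0 : P + W ≠ 0 := by intro h; exact hQ (by rw [← hPW, h, nsmul_zero])
  -- The reflected function is the translate by `P + W` of `conj h_W`, which has its zero of order
  -- `ℓ` at `-W`.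
  have hm := multiplies_translate_pow hPW0 (neg_ne_zero.mpr hW0)
    (by rwa [add_neg_cancel_right]) (conj_mem_pointIdeal_neg_pow hW0
      ((Ideal.span_singleton_le_iff_mem _).mp (span_millerFunction hW).le))
    ((normDegree_conj _).trans (normDegree_millerFunction hW hW0)).le
  rw [add_neg_cancel_right] at hm
  -- The constant factor `1` carries the simple zero at `-Q` along.
  obtain ⟨u, hu, h⟩ := hm.mul (Multiplies.const (I := pointIdeal (-Q)) 1)
    (divisionFunction ℓ Q (P + W))
    ((Ideal.span_singleton_le_iff_mem _).mp (span_divisionFunction hPW).le)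
  simp only [mul_one] at h
  rw [← span_divisionFunction hP, Ideal.mem_span_singleton'] at hu
  obtain ⟨r, rfl⟩ := hu
  have hd := (divisionFunction_spec hP).normDegree
  have hd' := (divisionFunction_spec hPW).normDegree
  have hmonic := (divisionFunction_spec hP).monic
  have hmonic' := (divisionFunction_spec hPW).monic
  rw [sum_affineCount_division hP0 hQ] at hd hmonic
  rw [sum_affineCount_division hPW0 hQ] at hd' hmonic'
  have hsub := normDegree_sub_lt_of_translate hPW0 hd'.le h
  have hdeg := normDegree_le_of_translate hPW0 hd'.le h
  obtain ⟨c, rfl⟩ := exists_eq_const_of_normDegree_mul_le hd hdeg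
  rw [value_conj, neg_neg] at hsub
  -- Both division functions are normalized of the same order `ℓ + 1`. If the constants differed,
  -- their difference times `g_P` would have smaller pole order than `g_P`.
  have hc : c = value (millerFunction ℓ W) (P + W) := by
    by_contra hc
    have h1 : normDegree ((c - value (millerFunction ℓ W) (P + W)) • divisionFunction ℓ Q P) <
        (ℓ + 1 : ℕ) := by
      have h2 : (c - value (millerFunction ℓ W) (P + W)) • divisionFunction ℓ Q P =
          (const E c * divisionFunction ℓ Q P -
            value (millerFunction ℓ W) (P + W) • divisionFunction ℓ Q (P + W)) +
          value (millerFunction ℓ W) (P + W) • (divisionFunction ℓ Q (P + W) -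
            divisionFunction ℓ Q P) := by
        rw [← smul_eq_const_mul, sub_smul, smul_sub]
        abel
      rw [h2]
      exact (normDegree_add_le _ _).trans_lt (max_lt hsub ((normDegree_smul_le _ _).trans_lt
        (hmonic'.normDegree_sub_lt hmonic)))
    rw [smul_eq_const_mul, normDegree_mul, normDegree_const (sub_ne_zero.mpr hc), zero_add,
      hd] at h1
    exact lt_irrefl _ h1
  have := h X hX hXP
  rw [value_mul, value_const _ hX, value_conj, neg_sub, hc] at this
  rw [this, mul_comm]

/-- Evaluate `value_divisionFunction_mul` at `X = V` and the commutator identity at `X = P + W`,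
then cancel `h_W(P + W - V)`. Since `ℓ P = Q ≠ 0`, no point involved is a zero of a denominator. -/
theorem sectorQuotient_add (hP : ℓ • P = Q) (hQ : Q ≠ 0) (hV : ℓ • V = 0) (hV0 : V ≠ 0)
    (hW : ℓ • W = 0) (hW0 : W ≠ 0) {ε : F}
    (hε : ∀ X, X ≠ 0 → X ≠ V → X ≠ W →
      value (millerFunction ℓ V) (X - W) * value (millerFunction ℓ W) X =
        ε * (value (millerFunction ℓ W) (X - V) * value (millerFunction ℓ V) X)) :
    sectorQuotient ℓ Q V (P + W) = ε * sectorQuotient ℓ Q V P := by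
  have hne : ∀ T, ℓ • T = 0 → P ≠ T := by
    rintro T hT rfl
    exact hQ (by rw [← hP, hT])
  have hPW0 : P + W ≠ 0 := fun h => hne (-W) (by rw [smul_neg, hW, neg_zero])
    (eq_neg_of_add_eq_zero_left h)
  have hPWV : P + W ≠ V := fun h => hne (V - W) (by rw [smul_sub, hW, hV, sub_zero])
    (eq_sub_of_add_eq h)
  have h1 := value_divisionFunction_mul hP hQ hW hW0 hV0 hPWV.symm
  have h2 := hε (P + W) hPW0 hPWV (by simpa using hne 0 (nsmul_zero _))
  rw [add_sub_cancel_right] at h2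
  have n1 := value_millerFunction_ne_zero hV (hne 0 (nsmul_zero _)) (hne V hV)
  have n2 := value_millerFunction_ne_zero hV hPW0 hPWV
  have n3 : value (millerFunction ℓ W) (P + W - V) ≠ 0 :=
    value_millerFunction_ne_zero hW (sub_ne_zero.mpr hPWV)
      fun h => hne V hV (by rw [add_sub_right_comm] at h; simpa [sub_eq_zero] using h)
  rw [sectorQuotient, sectorQuotient, mul_div_assoc', div_eq_div_iff n2 n1]
  refine mul_right_cancel₀ n3 ?_
  linear_combination value (millerFunction ℓ V) P * h1 +
    value (divisionFunction ℓ Q P) V * h2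

end Pairing

/-! ### The spaces `L(n P_∞)` -/

section RiemannRoch

variable {F : Type*} [Field F] (E : WeierstrassCurve.Affine F)

/-- The space `L(n P_∞)` of the polynomial functions with a pole of order at most `n`. -/
noncomputable def poleSubmodule (n : ℕ) : Submodule F E.CoordinateRing where
  carrier := {f | normDegree f ≤ n}
  add_mem' hf hg := (normDegree_add_le _ _).trans (max_le hf hg)
  zero_mem' := by simp
  smul_mem' c f hf := (normDegree_smul_le c f).trans hf

instance finiteDimensional_poleSubmodule (n : ℕ) : FiniteDimensional F (poleSubmodule E n) := by
  let φ : (F[X] × F[X]) →ₗ[F] E.CoordinateRing :=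
    (((LinearMap.toSpanSingleton F[X] E.CoordinateRing 1).coprod
      (LinearMap.toSpanSingleton F[X] E.CoordinateRing (CoordinateRing.mk E X))).restrictScalars F)
  have h : poleSubmodule E n ≤
      ((degreeLT F (n + 1)).prod (degreeLT F (n + 1))).map φ := by
    intro f hf
    obtain ⟨p, q, rfl⟩ := CoordinateRing.exists_smul_basis_eq f
    change normDegree _ ≤ _ at hf
    rw [normDegree_smul_basis, max_le_iff] at hf
    refine ⟨(p, q), ⟨mem_degreeLT.mpr ?_, mem_degreeLT.mpr ?_⟩, rfl⟩
    · rcases eq_or_ne p 0 with rfl | hp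
      · simp
      · have := hf.1
        rw [degree_eq_natDegree hp] at this ⊢
        rw [two_nsmul_coe] at this
        norm_cast at this ⊢
        omega
    · rcases eq_or_ne q 0 with rfl | hp
      · simp
      · have := hf.2
        rw [degree_eq_natDegree hp] at this ⊢
        rw [two_nsmul_coe] at this
        norm_cast at this ⊢
        omega
  have h1 : (degreeLT F (n + 1)).FG := Module.Finite.iff_fg.mp
    (Module.Finite.equiv (degreeLTEquiv F (n + 1)).symm)
  have := Module.Finite.iff_fg.mpr ((h1.prod h1).map φ)
  exact Submodule.finiteDimensional_of_le h

end RiemannRoch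

/-- Two commuting endomorphisms of a nonzero finite-dimensional space over an algebraically closed
field have a common eigenvector. -/
theorem exists_common_eigenvector {F L : Type*} [Field F] [IsAlgClosed F] [AddCommGroup L]
    [Module F L] [FiniteDimensional F L] [Nontrivial L] {S T : Module.End F L} (h : Commute S T) :
    ∃ v, v ≠ 0 ∧ (∃ a : F, S v = a • v) ∧ ∃ b : F, T v = b • v := by
  obtain ⟨a, ha⟩ := Module.End.exists_eigenvalue S
  have hmaps : ∀ v ∈ S.eigenspace a, T v ∈ S.eigenspace a := by
    intro v hv
    rw [Module.End.mem_eigenspace_iff] at hv ⊢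
    rw [← Module.End.mul_apply, h.eq, Module.End.mul_apply, hv, map_smul]
  have : Nontrivial (S.eigenspace a) := Submodule.nontrivial_iff_ne_bot.mpr ha
  obtain ⟨b, hb⟩ := Module.End.exists_eigenvalue (T.restrict hmaps)
  obtain ⟨v, hv⟩ := hb.exists_hasEigenvector
  refine ⟨v, fun h => hv.2 (Subtype.ext h), ⟨a, Module.End.mem_eigenspace_iff.mp v.2⟩, b, ?_⟩
  exact congrArg Subtype.val hv.apply_eq_smul

/-! ### Nondegeneracy of the commutator -/

section Nondegenerate

variable {F : Type*} [Field F] [DecidableEq F] {E : WeierstrassCurve.Affine F} {ℓ : ℕ}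
  {V W : E.Point}

/-- A function in `L(n P_∞)` with a zero, whose zeros are stable under translation by two
independent points of order `n`, vanishes. -/
theorem eq_zero_of_zeros_stable {n : ℕ} (hn : 2 ≤ n)
    (hind : ∀ a b : ℤ, a • W + b • V = 0 → (n : ℤ) ∣ a ∧ (n : ℤ) ∣ b) {f : E.CoordinateRing}
    (hf : normDegree f ≤ n) {Z : E.Point → Prop} (hZ : ∀ z, Z z ↔ z ≠ 0 ∧ value f z = 0)
    (hW : ∀ z, Z z → z + W ≠ 0 → Z (z + W)) (hV : ∀ z, Z z → z + V ≠ 0 → Z (z + V))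
    {z : E.Point} (hz : Z z) : f = 0 := by
  by_contra hf0
  have hVW : ∀ a : ℤ, V ≠ a • W := by
    intro a h
    have h1 := (hind a (-1) (by rw [← h, neg_one_zsmul, add_neg_cancel])).2
    have := Int.le_of_dvd one_pos (Int.dvd_neg.mp h1)
    omega
  have hW0 : W ≠ 0 := by
    rintro rfl
    have := Int.le_of_dvd one_pos (hind 1 0 (by simp)).1
    omega
  -- A row `z + ⟨W⟩` outside `⟨W⟩` never meets `0`, so stability applies all along it.
  have hrow : ∀ z, Z z → (∀ a : ℤ, z ≠ a • W) → ∀ m : ℕ, Z (z + m • W) := by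
    intro z hz hzW m
    induction m with
    | zero => simpa using hz
    | succ m ih =>
      rw [succ_nsmul, ← add_assoc]
      refine hW _ ih fun h => hzW (-(m + 1 : ℕ)) ?_
      rw [neg_zsmul, natCast_zsmul, succ_nsmul, eq_neg_iff_add_eq_zero, ← add_assoc, h]
  -- A full row gives `n` distinct zeros, and one zero `e` outside it exceeds the pole order.
  have hcontra : ∀ z e, Z z → (∀ a : ℤ, z ≠ a • W) → Z e → (∀ a : ℤ, e ≠ z + a • W) → False := by
    intro z e hz hzW he hez
    have hinj : Set.InjOn (fun m : ℕ => z + m • W) (Finset.range n) := by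
      intro a ha b hb hab
      have hab' : ((a : ℤ) - b) • W + (0 : ℤ) • V = 0 := by
        rw [zero_smul, add_zero, sub_smul, natCast_zsmul, natCast_zsmul, sub_eq_zero]
        exact add_left_cancel hab
      obtain ⟨k, hk⟩ := (hind _ _ hab').1
      have ha := Finset.mem_range.mp ha
      have hb := Finset.mem_range.mp hb
      have hlt : |(a : ℤ) - b| < n := by rw [abs_lt]; omega
      have := Int.eq_zero_of_abs_lt_dvd ⟨k, hk⟩ hlt
      omega
    have hcard := card_zeros_le hf0
      (insert e ((Finset.range n).image fun m : ℕ => z + m • W)) fun P hP => by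
        rw [← hZ]
        rcases Finset.mem_insert.mp hP with rfl | hP
        · exact he
        · obtain ⟨m, -, rfl⟩ := Finset.mem_image.mp hP
          exact hrow z hz hzW m
    rw [Finset.card_insert_of_notMem, Finset.card_image_of_injOn hinj, Finset.card_range] at hcard
    · have := hcard.trans hf
      norm_cast at this
      omega
    · intro he
      obtain ⟨m, -, hm⟩ := Finset.mem_image.mp he
      exact hez m (by rw [natCast_zsmul, hm])
  -- If `z` lies in `⟨W⟩`, take the row of `z + V` and the extra zero `z`. Otherwise take the row of
  -- `z` and the extra zero `z + V`, or `z + W + V = W` when `z + V = 0`.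
  by_cases hzW : ∃ a : ℤ, z = a • W
  · obtain ⟨a, rfl⟩ := hzW
    have h1 : ∀ b : ℤ, a • W + V ≠ b • W := fun b h =>
      hVW (b - a) (by rw [sub_smul, ← h, add_sub_cancel_left])
    refine hcontra (a • W + V) (a • W) (hV _ hz fun h => h1 0 (by rw [h, zero_smul])) h1 hz
      fun b h => hVW (-b) ?_
    rw [add_assoc, left_eq_add] at h
    rw [neg_smul]
    exact eq_neg_of_add_eq_zero_left h
  · push Not at hzW
    by_cases h0 : z + V = 0
    · have hzW' : Z (z + W) := by simpa using hrow z hz hzW 1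
      have h1 : z + W + V = W := by rw [add_right_comm, h0, zero_add]
      refine hcontra z (z + W + V) hz hzW (hV _ hzW' (by rwa [h1])) fun a h => hVW (a - 1) ?_
      rw [add_assoc, add_right_inj] at h
      rw [sub_smul, one_smul, ← h, add_sub_cancel_left]
    · refine hcontra z (z + V) hz hzW (hV _ hz h0) fun a h => hVW a ?_
      exact add_left_cancel h

variable [IsAlgClosed F] [E.IsElliptic] [E.IsShortNF]

/-- The translation operator `f ↦ f(X - W) h_W(X)` on `L(ℓ P_∞)`. -/
theorem exists_translation_operator (hW : ℓ • W = 0) (hW0 : W ≠ 0) :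
    ∃ T : Module.End F (poleSubmodule E ℓ), ∀ (f : poleSubmodule E ℓ) (X : E.Point), X ≠ 0 →
      X ≠ W → value (T f : E.CoordinateRing) X =
        value (f : E.CoordinateRing) (X - W) * value (millerFunction ℓ W) X := by
  have hd := (normDegree_millerFunction hW hW0).le
  have : ∀ f : poleSubmodule E ℓ, ∃ u : poleSubmodule E ℓ, ∀ X, X ≠ 0 → X ≠ W →
      value (u : E.CoordinateRing) X =
        value (f : E.CoordinateRing) (X - W) * value (millerFunction ℓ W) X := by
    intro f
    obtain ⟨u, -, hu⟩ := multiplies_translate hW0 f.2 (millerFunction ℓ W)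
      ((Ideal.span_singleton_le_iff_mem _).mp (span_millerFunction hW).le)
    exact ⟨⟨u, normDegree_le_of_translate hW0 hd hu⟩, hu⟩
  choose T hT using this
  refine ⟨⟨⟨T, fun f g => ?_⟩, fun c f => ?_⟩, hT⟩
  · refine Subtype.ext (eq_of_value_eq (S := {0, W}) (by simp) fun X hX => ?_)
    simp only [Set.mem_insert_iff, Set.mem_singleton_iff, not_or] at hX
    rw [hT _ X hX.1 hX.2, Submodule.coe_add, Submodule.coe_add, value_add, value_add,
      hT _ X hX.1 hX.2, hT _ X hX.1 hX.2, add_mul]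
  · refine Subtype.ext (eq_of_value_eq (S := {0, W}) (by simp) fun X hX => ?_)
    simp only [Set.mem_insert_iff, Set.mem_singleton_iff, not_or] at hX
    rw [hT _ X hX.1 hX.2, RingHom.id_apply, Submodule.coe_smul, Submodule.coe_smul, value_smul,
      value_smul, hT _ X hX.1 hX.2, mul_assoc]

/-- The translations by two independent `ℓ`-torsion points do not commute. -/
theorem commutator_ne_one (hℓ : 2 ≤ ℓ) (hV : ℓ • V = 0) (hW : ℓ • W = 0)
    (hind : ∀ a b : ℤ, a • W + b • V = 0 → (ℓ : ℤ) ∣ a ∧ (ℓ : ℤ) ∣ b) {ε : F}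
    (hε : ∀ X, X ≠ 0 → X ≠ V → X ≠ W →
      value (millerFunction ℓ V) (X - W) * value (millerFunction ℓ W) X =
        ε * (value (millerFunction ℓ W) (X - V) * value (millerFunction ℓ V) X)) : ε ≠ 1 := by
  rintro rfl
  have hW0 : W ≠ 0 := by
    rintro rfl
    have := Int.le_of_dvd one_pos (hind 1 0 (by simp)).1
    omega
  have hV0 : V ≠ 0 := by
    rintro rfl
    have := Int.le_of_dvd one_pos (hind 0 1 (by simp)).2
    omega
  obtain ⟨S, hS⟩ := exists_translation_operator hW hW0
  obtain ⟨T, hT⟩ := exists_translation_operator hV hV0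
  -- The two composites multiply `f(X - V - W)` by the two sides of `hε`, here with `ε = 1`.
  have hcomm : Commute S T := by
    refine LinearMap.ext fun f => Subtype.ext (eq_of_value_eq (S := {0, V, W, V + W})
      (Set.toFinite _) fun X hX => ?_)
    simp only [Set.mem_insert_iff, Set.mem_singleton_iff, not_or] at hX
    obtain ⟨h0, hXV, hXW, hXVW⟩ := hX
    rw [Module.End.mul_apply, Module.End.mul_apply, hS _ X h0 hXW, hT _ X h0 hXV,
      hS _ _ (sub_ne_zero.mpr hXV) fun h => hXVW (by rw [← h, add_sub_cancel]),
      hT _ _ (sub_ne_zero.mpr hXW) fun h => hXVW (by rw [← h, sub_add_cancel]),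
      sub_right_comm X V W, mul_assoc, mul_assoc, hε X h0 hXV hXW, one_mul]
  have : Nontrivial (poleSubmodule E ℓ) := by
    refine ⟨⟨1, ?_⟩, 0, fun h => one_ne_zero (congrArg Subtype.val h)⟩
    change normDegree 1 ≤ _
    rw [← map_one (const E)]
    exact (normDegree_const_le _).trans (by norm_cast; omega)
  obtain ⟨f, hf0, ⟨a, ha⟩, b, hb⟩ := exists_common_eigenvector hcomm
  have hne : (f : E.CoordinateRing) ≠ 0 := fun h => hf0 (Subtype.ext h)
  have eigen : ∀ {W : E.Point} {S : Module.End F (poleSubmodule E ℓ)} {a : F},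
      (∀ (f : poleSubmodule E ℓ) (X : E.Point), X ≠ 0 →
      X ≠ W → value (S f : E.CoordinateRing) X =
        value (f : E.CoordinateRing) (X - W) * value (millerFunction ℓ W) X) → S f = a • f →
      ∀ X, X ≠ 0 → X ≠ W → a * value (f : E.CoordinateRing) X =
        value (f : E.CoordinateRing) (X - W) * value (millerFunction ℓ W) X := by
    intro W S a hS ha X h0 hX
    rw [← hS f X h0 hX, ha, Submodule.coe_smul, value_smul]
  have stable : ∀ {W : E.Point} {a : F}, ℓ • W = 0 →
      (∀ X, X ≠ 0 → X ≠ W → a * value (f : E.CoordinateRing) X =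
        value (f : E.CoordinateRing) (X - W) * value (millerFunction ℓ W) X) →
      ∀ z, (z ≠ 0 ∧ value (f : E.CoordinateRing) z = 0) → z + W ≠ 0 →
        (z + W ≠ 0 ∧ value (f : E.CoordinateRing) (z + W) = 0) := by
    intro W a hW h z hz hzW
    -- Eigenvalue zero would force `f = 0`, since `h_W` has no zero other than `W`.
    have ha0 : a ≠ 0 := by
      rintro rfl
      refine hne (eq_of_value_eq (S := {0, -W}) (by simp) fun X hX => ?_)
      simp only [Set.mem_insert_iff, Set.mem_singleton_iff, not_or] at hX
      have hXW : X + W ≠ 0 := fun h => hX.2 (eq_neg_of_add_eq_zero_left h)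
      have h1 := h (X + W) hXW (by simpa using hX.1)
      rw [zero_mul, add_sub_cancel_right, eq_comm, mul_eq_zero] at h1
      rw [value_zero]
      exact h1.resolve_right (value_millerFunction_ne_zero hW hXW (by simpa using hX.1))
    refine ⟨hzW, ?_⟩
    have h1 := h (z + W) hzW (by simpa using hz.1)
    rw [add_sub_cancel_right, hz.2, zero_mul] at h1
    exact (mul_eq_zero.mp h1).resolve_left ha0
  have eS := eigen hS ha
  have eT := eigen hT hb
  -- A constant eigenvector would make `h_W` constant, whereas its pole order is `ℓ`.
  have hpos : 0 < normDegree (f : E.CoordinateRing) := by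
    by_contra hle
    obtain ⟨c, hc⟩ := exists_eq_const_of_normDegree_le (not_lt.mp hle)
    have hc0 : c ≠ 0 := by
      rintro rfl
      exact hne (by rw [hc, map_zero])
    have h1 : const E a = millerFunction ℓ W := by
      refine eq_of_value_eq (S := {0, W}) (by simp) fun X hX => ?_
      simp only [Set.mem_insert_iff, Set.mem_singleton_iff, not_or] at hX
      have := eS X hX.1 hX.2
      rw [hc, value_const _ hX.1, value_const _ (sub_ne_zero.mpr hX.2)] at this
      rw [value_const _ hX.1]
      exact mul_right_cancel₀ hc0 (this.trans (mul_comm _ _))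
    have h2 := normDegree_const_le (E := E) a
    rw [h1, normDegree_millerFunction hW hW0] at h2
    norm_cast at h2
    omega
  obtain ⟨z, hz⟩ := exists_zero_of_normDegree_pos hpos
  exact hne (eq_zero_of_zeros_stable hℓ hind f.2
    (Z := fun z => z ≠ 0 ∧ value (f : E.CoordinateRing) z = 0) (fun _ => Iff.rfl)
    (stable hW eS) (stable hV eT) hz)

end Nondegenerate

/-! ### Base change of functions and points -/

section BaseChange

variable {k : Type*} [Field k] (K : Type*) [Field K] [Algebra k K] {E : WeierstrassCurve.Affine k}

/-- Base change of polynomial functions. -/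
noncomputable def mapFunction : E.CoordinateRing →+* (E.map (algebraMap k K)).CoordinateRing :=
  CoordinateRing.map E (algebraMap k K)

theorem mapFunction_smul_basis (p q : k[X]) :
    mapFunction K (p • (1 : E.CoordinateRing) + q • CoordinateRing.mk E X) =
      p.map (algebraMap k K) • 1 +
        q.map (algebraMap k K) • CoordinateRing.mk (E.map (algebraMap k K)) X := by
  rw [mapFunction, map_add, CoordinateRing.map_smul, CoordinateRing.map_smul, map_one, CoordinateRing.map_mk,
    map_X]

theorem mapFunction_const (c : k) :
    mapFunction K (const E c) = const (E.map (algebraMap k K)) (algebraMap k K c) := by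
  refine (CoordinateRing.map_mk _ _).trans ?_
  simp [const]

theorem mapFunction_xCoord : mapFunction K (xCoord E) = xCoord (E.map (algebraMap k K)) := by
  refine (CoordinateRing.map_mk _ _).trans ?_
  simp [xCoord]

theorem mapFunction_yCoord : mapFunction K (yCoord E) = yCoord (E.map (algebraMap k K)) := by
  refine (CoordinateRing.map_mk _ _).trans ?_
  simp [yCoord]

theorem IsMonicAtInfinity.map {n : ℕ} {f : E.CoordinateRing} (hf : IsMonicAtInfinity n f) :
    IsMonicAtInfinity n (mapFunction K f) := by
  obtain ⟨p, q, rfl, hp, hq, h1⟩ := hf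
  refine ⟨_, _, mapFunction_smul_basis K p q, fun i hi => hp i fun h => hi ?_,
    fun i hi => hq i fun h => hi ?_, ?_⟩
  · rw [coeff_map, h, map_zero]
  · rw [coeff_map, h, map_zero]
  · rw [coeff_map, coeff_map, ← apply_ite (algebraMap k K), h1, map_one]

variable [DecidableEq k] [DecidableEq K]

/-- Base change of points. -/
noncomputable def mapPoint : E.Point →+ (E.map (algebraMap k K)).Point :=
  Point.baseChange (W' := E) k K

theorem mapPoint_injective : Function.Injective (mapPoint (E := E) K) :=
  Point.map_injective (W' := E) (Algebra.ofId k K)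

theorem mapPoint_some {x y : k} (h : E.Nonsingular x y) :
    ∃ h', mapPoint K (.some x y h) = .some (algebraMap k K x) (algebraMap k K y) h' :=
  ⟨_, Point.map_some (W' := E) (Algebra.ofId k K) h⟩

theorem value_mapFunction (f : E.CoordinateRing) (P : E.Point) :
    value (mapFunction K f) (mapPoint K P) = algebraMap k K (value f P) := by
  rcases eq_or_ne P 0 with rfl | hP
  · simp
  have hP' : mapPoint K P ≠ 0 := (map_ne_zero_iff _ (mapPoint_injective K)).mpr hP
  induction f using induction_coordinateRing with
  | hc c => rw [mapFunction_const, value_const _ hP', value_const _ hP]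
  | hx =>
    obtain ⟨x, y, h, rfl⟩ := (ne_zero_iff_exists_some P).mp hP
    obtain ⟨h', e⟩ := mapPoint_some K h
    rw [mapFunction_xCoord, e, value_xCoord, value_xCoord]
  | hy =>
    obtain ⟨x, y, h, rfl⟩ := (ne_zero_iff_exists_some P).mp hP
    obtain ⟨h', e⟩ := mapPoint_some K h
    rw [mapFunction_yCoord, e, value_yCoord, value_yCoord]
  | hadd f g hf hg => rw [map_add, value_add, hf, hg, value_add, map_add]
  | hmul f g hf hg => rw [map_mul, value_mul, hf, hg, value_mul, map_mul]

theorem map_pointIdeal (P : E.Point) :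
    (pointIdeal P).map (mapFunction K) = pointIdeal (mapPoint K P) := by
  rcases eq_or_ne P 0 with rfl | hP
  · rw [map_zero]
    exact Ideal.map_top _
  obtain ⟨x, y, h, rfl⟩ := (ne_zero_iff_exists_some P).mp hP
  obtain ⟨h', e⟩ := mapPoint_some K h
  rw [e]
  simp only [pointIdeal, CoordinateRing.XYIdeal, Ideal.map_span, Set.image_pair]
  congr 2
  · refine (CoordinateRing.map_mk _ _).trans ?_
    simp [CoordinateRing.XClass]
  · congr 1
    refine (CoordinateRing.map_mk _ _).trans ?_
    simp [CoordinateRing.YClass]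

theorem affineCount_mapPoint (P : E.Point) : affineCount (mapPoint K P) = affineCount P := by
  rcases eq_or_ne P 0 with rfl | hP
  · rw [map_zero]; rfl
  · rw [affineCount_of_ne_zero hP,
      affineCount_of_ne_zero ((map_ne_zero_iff _ (mapPoint_injective K)).mpr hP)]

theorem IsNormalizedWithZeros.map {s : Multiset E.Point} {f : E.CoordinateRing}
    (hf : IsNormalizedWithZeros s f) :
    IsNormalizedWithZeros (s.map (mapPoint K)) (mapFunction K f) := by
  refine ⟨?_, ?_⟩
  · have h := congrArg (Ideal.map (mapFunction K)) hf.span_eq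
    rw [Ideal.map_span, Set.image_singleton] at h
    rw [h, Multiset.map_map, ← Ideal.mapHom_apply, _root_.map_multiset_prod, Multiset.map_map]
    simp only [Function.comp_def, Ideal.mapHom_apply, map_pointIdeal]
  · have h := hf.monic.map K
    simpa only [Multiset.map_map, Function.comp_def, affineCount_mapPoint] using h

/-- The base-changed function has the base-changed zeros and is still normalized, so uniqueness
applies. -/
theorem normalizedFunction_map {s : Multiset E.Point} (hs : s.sum = 0) :
    normalizedFunction (s.map (mapPoint K)) = mapFunction K (normalizedFunction s) :=
  (normalizedFunction_spec (by rw [← map_multiset_sum, hs, map_zero])).unique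
    ((normalizedFunction_spec hs).map K)

theorem millerFunction_map {ℓ : ℕ} {W : E.Point} (hW : ℓ • W = 0) :
    millerFunction ℓ (mapPoint K W) = mapFunction K (millerFunction ℓ W) := by
  rw [millerFunction, millerFunction, ← normalizedFunction_map K
    (by rw [Multiset.sum_replicate, hW]), Multiset.map_replicate]

theorem divisionFunction_map {ℓ : ℕ} {P Q : E.Point} (hP : ℓ • P = Q) :
    divisionFunction ℓ (mapPoint K Q) (mapPoint K P) = mapFunction K (divisionFunction ℓ Q P) := by
  rw [divisionFunction, divisionFunction, ← normalizedFunction_map K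
    (by rw [Multiset.sum_add, Multiset.sum_replicate, hP, Multiset.sum_singleton, add_neg_cancel]),
    Multiset.map_add, Multiset.map_replicate, Multiset.map_singleton, map_neg]

theorem sectorQuotient_map {ℓ : ℕ} {P Q W : E.Point} (hP : ℓ • P = Q) (hW : ℓ • W = 0) :
    sectorQuotient ℓ (mapPoint K Q) (mapPoint K W) (mapPoint K P) =
      algebraMap k K (sectorQuotient ℓ Q W P) := by
  rw [sectorQuotient, sectorQuotient, millerFunction_map K hW, divisionFunction_map K hP,
    value_mapFunction, value_mapFunction, map_div₀]

instance isShortNF_map [E.IsShortNF] : (E.map (algebraMap k K)).IsShortNF where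
  a₁ := by simp
  a₂ := by simp
  a₃ := by simp

end BaseChange

/-! ### Effect of torsion translations on `G_V` over the base field -/

section Ratio

variable {k : Type*} [Field k] [DecidableEq k] (K : Type*) [Field K] [DecidableEq K]
  [IsAlgClosed K] [Algebra k K] {E : WeierstrassCurve.Affine k} {ℓ : ℕ} {P Q V W : E.Point}

theorem sectorQuotient_ne_zero (hP : ℓ • P = Q) (hQ : Q ≠ 0) (hV : ℓ • V = 0) (hV0 : V ≠ 0)
    (hQV : Q ≠ -V) : sectorQuotient ℓ Q V P ≠ 0 := by
  have hPV : P ≠ V := by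
    rintro rfl
    exact hQ (by rw [← hP, hV])
  have hP0 : P ≠ 0 := by
    rintro rfl
    exact hQ (by rw [← hP, nsmul_zero])
  exact div_ne_zero (value_divisionFunction_ne_zero hP hV0 hPV.symm hQV)
    (value_millerFunction_ne_zero hV hP0 hPV)

theorem sectorQuotient_eq_of_eq {ω : k} (hP : ℓ • P = Q) (hQ : Q ≠ 0) (hV : ℓ • V = 0)
    (h : value (divisionFunction ℓ Q P) V = ω * value (millerFunction ℓ V) P) :
    sectorQuotient ℓ Q V P = ω := by
  have hPV : P ≠ V := by
    rintro rfl
    exact hQ (by rw [← hP, hV])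
  have hP0 : P ≠ 0 := by
    rintro rfl
    exact hQ (by rw [← hP, nsmul_zero])
  rw [sectorQuotient, h, mul_div_cancel_right₀ _ (value_millerFunction_ne_zero hV hP0 hPV)]

variable [E.IsElliptic] [E.IsShortNF]

/-- The constant is the commutator of the base-changed points, which involves only `V` and `W`;
hence it precedes the quantifier over `P`. -/
theorem exists_ratio (hℓ : 2 ≤ ℓ) (hV : ℓ • V = 0) (hV0 : V ≠ 0) (hW : ℓ • W = 0) (hW0 : W ≠ 0)
    (hVW : V + W ≠ 0) : ∃ ε : K, (∀ P, ℓ • P = Q → Q ≠ 0 →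
      algebraMap k K (sectorQuotient ℓ Q V (P + W)) =
        ε * algebraMap k K (sectorQuotient ℓ Q V P)) ∧
      ((∀ a b : ℤ, a • W + b • V = 0 → (ℓ : ℤ) ∣ a ∧ (ℓ : ℤ) ∣ b) → ε ≠ 1) := by
  have hinj := mapPoint_injective (E := E) K
  have hn : ∀ {T : E.Point}, T ≠ 0 → mapPoint K T ≠ 0 := fun h => (map_ne_zero_iff _ hinj).mpr h
  have ht : ∀ {T : E.Point}, ℓ • T = 0 → ℓ • mapPoint K T = 0 := fun h => by
    rw [← map_nsmul, h, map_zero]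
  obtain ⟨ε, hε⟩ := exists_commutator (ht hV) (ht hW) (hn hV0) (hn hW0)
    (by rw [← map_add]; exact hn hVW)
  refine ⟨ε, fun P hP hQ => ?_, fun hind => commutator_ne_one hℓ (ht hV) (ht hW)
    (fun a b h => hind a b (hinj ?_)) hε⟩
  · have hPW : ℓ • (P + W) = Q := by rw [nsmul_add, hP, hW, add_zero]
    rw [← sectorQuotient_map K hP hV, ← sectorQuotient_map K hPW hV, map_add]
    exact sectorQuotient_add (by rw [← map_nsmul, hP]) (hn hQ) (ht hV) (hn hV0) (ht hW)
      (hn hW0) hε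
  · rw [map_add, map_zsmul, map_zsmul, h, map_zero]

/-- The quotient `G_V(P + W) / G_V(P)` does not depend on `P`. -/
theorem exists_ratio_of_torsion (hℓ : 2 ≤ ℓ) (hV : ℓ • V = 0) (hV0 : V ≠ 0) {U : E.Point}
    (hU : ℓ • U = 0) (hU0 : U ≠ 0) (hVU : V + U ≠ 0) (hQ : Q ≠ 0) (hW : ℓ • W = 0) :
    ∃ ε : K, ∀ P, ℓ • P = Q → algebraMap k K (sectorQuotient ℓ Q V (P + W)) =
      ε * algebraMap k K (sectorQuotient ℓ Q V P) := by
  rcases eq_or_ne W 0 with rfl | hW0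
  · exact ⟨1, fun P _ => by rw [add_zero, one_mul]⟩
  by_cases hVW : V + W = 0
  -- For `W = -V` the comparison with `h_{V+W}` is unavailable; translate by `U` and then by `W -
  -- U`, neither of which is `-V`.
  · obtain ⟨ε, hε, -⟩ := exists_ratio K (Q := Q) hℓ hV hV0 hU hU0 hVU
    have hWU : ℓ • (W - U) = 0 := by rw [smul_sub, hW, hU, sub_zero]
    obtain ⟨δ, hδ, -⟩ := exists_ratio K (Q := Q) hℓ hV hV0 hWU
      (fun h => hVU (by rw [← sub_eq_zero.mp h, hVW]))
      (by rw [← add_sub_assoc, hVW, zero_sub]; exact neg_ne_zero.mpr hU0)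
    refine ⟨δ * ε, fun P hP => ?_⟩
    have hPU : ℓ • (P + U) = Q := by rw [nsmul_add, hP, hU, add_zero]
    have := hδ (P + U) hPU hQ
    rw [add_assoc, add_sub_cancel, hε P hP hQ] at this
    rw [this, mul_assoc]
  · obtain ⟨ε, hε, -⟩ := exists_ratio K (Q := Q) hℓ hV hV0 hW hW0 hVW
    exact ⟨ε, fun P hP => hε P hP hQ⟩

/-- Translation by a torsion point independent of `V` changes `G_V`. -/
theorem sectorQuotient_add_ne (hℓ : 2 ≤ ℓ) (hP : ℓ • P = Q) (hQ : Q ≠ 0) (hV : ℓ • V = 0)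
    (hQV : Q ≠ -V) (hW : ℓ • W = 0)
    (hind : ∀ a b : ℤ, a • W + b • V = 0 → (ℓ : ℤ) ∣ a ∧ (ℓ : ℤ) ∣ b) :
    sectorQuotient ℓ Q V (P + W) ≠ sectorQuotient ℓ Q V P := by
  classical
  have h1 : ¬ (ℓ : ℤ) ∣ 1 := fun h => by
    have := Int.le_of_dvd one_pos h
    omega
  have hV0 : V ≠ 0 := by
    rintro rfl
    exact h1 (hind 0 1 (by simp)).2
  obtain ⟨ε, hε, hε1⟩ := exists_ratio (AlgebraicClosure k) (Q := Q) hℓ hV hV0 hW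
    (by rintro rfl; exact h1 (hind 1 0 (by simp)).1)
    fun h => h1 (hind 1 1 (by rw [one_zsmul, one_zsmul, add_comm, h])).1
  intro heq
  have := hε P hP hQ
  rw [heq, eq_comm, mul_eq_right₀ ((_root_.map_ne_zero _).mpr
    (sectorQuotient_ne_zero hP hQ hV hV0 hQV))] at this
  exact hε1 hind this

end Ratio

/-! ### Characters with values in the roots of unity -/

section Character

/-- A nontrivial homomorphism to the group of `ℓ`-th roots of unity, `ℓ` prime, is onto. -/
theorem surjective_of_ne_one {G K : Type*} [Group G] [Field K] {ℓ : ℕ} (hℓ : ℓ.Prime)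
    (e : G →* rootsOfUnity ℓ K) {g : G} (hg : e g ≠ 1) : Function.Surjective e := by
  have : Fact ℓ.Prime := ⟨hℓ⟩
  have : NeZero ℓ := ⟨hℓ.ne_zero⟩
  have h1 : e g ^ ℓ = 1 := Subtype.ext (e g).2
  have hord : orderOf (e g) = ℓ := orderOf_eq_prime h1 hg
  have htop : Subgroup.zpowers (e g) = ⊤ := by
    -- There are at most `ℓ` roots of unity, and `e g` generates a subgroup of order `ℓ`.
    refine Subgroup.eq_top_of_le_card _ ?_
    rw [Nat.card_zpowers, hord]
    exact card_rootsOfUnity K ℓ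
  intro z
  obtain ⟨n, hn⟩ := Subgroup.mem_zpowers_iff.mp (htop ▸ Subgroup.mem_top z)
  exact ⟨g ^ n, by rw [map_zpow, hn]⟩

/-- A multiplicative function on a group of exponent `ℓ` is a character to the `ℓ`-th roots of
unity. -/
theorem exists_character {A K : Type*} [AddCommGroup A] [Field K] {ℓ : ℕ}
    (hA : ∀ a : A, ℓ • a = 0) (χ : A → K) (h1 : χ 0 = 1) (hmul : ∀ a b, χ (a + b) = χ a * χ b) :
    ∃ e : Multiplicative A →* rootsOfUnity ℓ K, ∀ a : A,
      ((e (Multiplicative.ofAdd a) : Kˣ) : K) = χ a := by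
  let ψ : Multiplicative A →* K :=
    { toFun := fun a => χ a.toAdd
      map_one' := h1
      map_mul' := fun a b => hmul _ _ }
  refine ⟨ψ.toHomUnits.codRestrict _ fun a => ?_, fun a => rfl⟩
  rw [mem_rootsOfUnity, ← map_pow]
  have : a ^ ℓ = 1 := hA a.toAdd
  rw [this, map_one]

end Character

end EllipticDivision

/-! ### The two assertions of the theorem -/

open EllipticDivision in
theorem mainTheorem7 {k : Type*} [Field k] [DecidableEq k] [DecidableEq (AlgebraicClosure k)]
    (h2 : (2 : k) ≠ 0) (h3 : (3 : k) ≠ 0)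
    (E : WeierstrassCurve.Affine k) [E.IsElliptic] [E.IsShortNF]
    (ℓ : ℕ) (hℓ : ℓ.Prime) (hℓk : (ℓ : k) ≠ 0)
    (W₁ W₂ : E.Point) (hW : IsTorsionBasis ℓ W₁ W₂)
    (Q : E.Point) (hQ : Q ≠ 0) (hQ₁ : Q ≠ -W₁) (hQ₂ : Q ≠ -W₂) :
    (∀ ω₁ ω₂ : k, IsSector ℓ Q W₁ ω₁ → IsSector ℓ Q W₂ ω₂ →
      ∀ P : E.Point, IsSolution ℓ Q W₁ W₂ ω₁ ω₂ P →
        ∀ W : E.Point, ℓ • W = 0 → W ≠ 0 → ¬ IsSolution ℓ Q W₁ W₂ ω₁ ω₂ (P + W)) ∧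
    (∀ P : E.Point, ℓ • P = Q →
      ∃ e : Multiplicative (AddSubgroup.torsionBy E.Point (ℓ : ℤ)) →*
          rootsOfUnity ℓ (AlgebraicClosure k),
        Function.Surjective e ∧
        ∀ W : AddSubgroup.torsionBy E.Point (ℓ : ℤ),
          ((e (Multiplicative.ofAdd W) : (AlgebraicClosure k)ˣ) : AlgebraicClosure k) =
            algebraMap k (AlgebraicClosure k)
              (sectorQuotient ℓ Q W₁ (P + W) / sectorQuotient ℓ Q W₁ P)) := by
  obtain ⟨hW₁, hW₂, hind, hspan⟩ := hW
  have hℓ2 := hℓ.two_le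
  have hℓ' : Prime (ℓ : ℤ) := Nat.prime_iff_prime_int.mp hℓ
  have hone : ¬ (ℓ : ℤ) ∣ 1 := fun h => hℓ'.not_isUnit (isUnit_of_dvd_one h)
  have hW₁0 : W₁ ≠ 0 := by
    rintro rfl
    exact hone (hind 1 0 (by simp)).1
  have hW₂0 : W₂ ≠ 0 := by
    rintro rfl
    exact hone (hind 0 1 (by simp)).2
  have hsum : W₁ + W₂ ≠ 0 := fun h => hone (hind 1 1 (by rw [one_zsmul, one_zsmul, h])).1
  refine ⟨?_, ?_⟩
  · rintro ω₁ ω₂ - - P hP W hWℓ hW0 hPW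
    have hT : ℓ • mapPoint (AlgebraicClosure k) W = 0 := by rw [← map_nsmul, hWℓ, map_zero]
    obtain ⟨a, b, hab⟩ := hspan _ hT
    replace hab : W = a • W₁ + b • W₂ := mapPoint_injective _ hab
    -- If `ℓ ∤ b`, then `W` is independent of `W₁` and the first equation fails. Otherwise `ℓ ∤ a`
    -- because `W ≠ 0`, so `W` is independent of `W₂` and the second equation fails.
    by_cases hb : (ℓ : ℤ) ∣ b
    · have ha : ¬ (ℓ : ℤ) ∣ a := by
        rintro ⟨c, rfl⟩
        obtain ⟨d, rfl⟩ := hb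
        refine hW0 ?_
        rw [hab, mul_comm, mul_smul, natCast_zsmul, hW₁, smul_zero, mul_comm, mul_smul,
          natCast_zsmul, hW₂, smul_zero, add_zero]
      refine sectorQuotient_add_ne hℓ2 hP.nsmul_eq hQ hW₂ hQ₂ hWℓ (fun c d h => ?_)
        ((sectorQuotient_eq_of_eq hPW.nsmul_eq hQ hW₂ hPW.eq₂).trans
          (sectorQuotient_eq_of_eq hP.nsmul_eq hQ hW₂ hP.eq₂).symm)
      have h4 := hind (c * a) (c * b + d) (by
        rw [← h, hab, smul_add, mul_smul, add_smul, mul_smul, add_assoc])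
      have hc := (hℓ'.dvd_or_dvd h4.1).resolve_right ha
      exact ⟨hc, (dvd_add_right (hc.mul_right b)).mp h4.2⟩
    · refine sectorQuotient_add_ne hℓ2 hP.nsmul_eq hQ hW₁ hQ₁ hWℓ (fun c d h => ?_)
        ((sectorQuotient_eq_of_eq hPW.nsmul_eq hQ hW₁ hPW.eq₁).trans
          (sectorQuotient_eq_of_eq hP.nsmul_eq hQ hW₁ hP.eq₁).symm)
      have h4 := hind (c * a + d) (c * b) (by
        rw [← h, hab, smul_add, mul_smul, add_smul, mul_smul, add_right_comm])
      have hc := (hℓ'.dvd_or_dvd h4.2).resolve_right hb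
      exact ⟨hc, (dvd_add_right (hc.mul_right a)).mp h4.1⟩
  · intro P hP
    have ht : ∀ W : AddSubgroup.torsionBy E.Point (ℓ : ℤ), ℓ • (W : E.Point) = 0 := fun W => by
      rw [← natCast_zsmul]
      exact W.2
    have hG : sectorQuotient ℓ Q W₁ P ≠ 0 := sectorQuotient_ne_zero hP hQ hW₁ hW₁0 hQ₁
    have hG' := (map_ne_zero (algebraMap k (AlgebraicClosure k))).mpr hG
    obtain ⟨e, he⟩ := exists_character (ℓ := ℓ) (fun W => Subtype.ext (ht W))
      (fun W : AddSubgroup.torsionBy E.Point (ℓ : ℤ) => algebraMap k (AlgebraicClosure k)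
        (sectorQuotient ℓ Q W₁ (P + W) / sectorQuotient ℓ Q W₁ P))
      (by simp [div_self hG]) fun W W' => by
        -- The same `ε` serves the base points `P` and `P + W'`, which is multiplicativity.
        obtain ⟨ε, hε⟩ := exists_ratio_of_torsion (AlgebraicClosure k) hℓ2 hW₁ hW₁0 hW₂ hW₂0 hsum
          hQ (ht W)
        have hPW : ℓ • (P + W') = Q := by rw [nsmul_add, hP, ht, add_zero]
        rw [map_div₀, map_div₀, map_div₀, hε P hP, AddSubgroup.coe_add, add_comm (W : E.Point),
          ← add_assoc, hε _ hPW, mul_div_assoc, mul_div_assoc, div_self hG', mul_one]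
    refine ⟨e, ?_, he⟩
    have hW₂' : W₂ ∈ AddSubgroup.torsionBy E.Point (ℓ : ℤ) := by
      change (ℓ : ℤ) • W₂ = 0
      rw [natCast_zsmul, hW₂]
    -- The character is nontrivial at `W₂`, which is independent of `W₁`.
    refine surjective_of_ne_one hℓ e (g := Multiplicative.ofAdd ⟨W₂, hW₂'⟩) fun h => ?_
    have h4 := he ⟨W₂, hW₂'⟩
    rw [h] at h4
    refine sectorQuotient_add_ne hℓ2 hP hQ hW₁ hQ₁ hW₂
      (fun a b h => (hind b a (by rw [add_comm, h])).symm) ?_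
    rw [← div_eq_one_iff_eq hG]
    refine (algebraMap k (AlgebraicClosure k)).injective ?_
    rw [map_one, ← h4]
    rfl
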